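/- Let $M$ be a smooth manifold (finite-dimensional, Hausdorff, without boundary). Let $GL(TM)$ be the groupoid of all linear isomorphisms $\xi:T_xM\to T_yM$, $x,y\in M$, with its usual manifold structure, source $\alpha(\xi)=x$, target $\beta(\xi)=y$, and multiplication given by composition. A *local bisection* of $GL(TM)$ is a smooth section $b:U\to GL(TM)$ of $\alpha$ over an open set $U\subset M$ such that $\beta\circ b$ is a diffeomorphism of $U$ onto an open subset of $M$; it is *global* if $U=M=\beta(b(U))$. For a vector field $Y$, the local vector field $b(Y)$ takes the value $b(x)Y_x$ at $\beta(b(x))$. The 1-jet $j^1_xb$ is identified with the linear map $b_{*x}:T_xM\to T_{b(x)}GL(TM)$, with image $D(j^1_xb)=b_{*x}(T_xM)$. A *symmetry jet* $\mathfrak s$ on $M$ is a smooth assignment $x\mapsto\mathfrak s(x)=j^1_xs_x$ of 1-jets of local bisections $s_x$ of $GL(TM)$, defined near $x$, such that $s_x(x)=-I_x$ and $(\beta\circ s_x)_{*x}=-I_x$. It induces an affine connection $$(\nabla^{\mathfrak s}_XY)_x=\tfrac12\,[X,\,Y+s_x(Y)]_x .$$ A local diffeomorphism $\varphi:U\to V$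 between open subsets of $M$ is *affine* if $\varphi_*(\nabla^{\mathfrak s}_XY)=\nabla^{\mathfrak s}_{\varphi_*X}\varphi_*Y$ for all smooth vector fields $X,Y$ on $U$. The *affine distribution* $\mathcal D^{\mathfrak s}$ on $GL(TM)$ is defined, for $\xi:T_xM\to T_yM$, by $$\mathcal D^{\mathfrak s}_\xi=\{v\in T_\xi GL(TM)\;:\;\psi_\xi(v)=-v,\ \ \beta_*v=\xi(\alpha_*v)\},\qquad \psi_\xi(v)=\overline Y\cdot v\cdot\overline X,$$ where $\overline X\in D(\mathfrak s(x))$ is the vector with $\beta_*\overline X=\alpha_*v$, $\overline Y\in D(\mathfrak s(y))$ is the vector with $\alpha_*\overline Y=\beta_*v$, and the dot is the differential of the groupoid multiplication. A local bisection $b:U\to GL(TM)$ is a *leaf* of $\mathcal D^{\mathfrak s}$ if it is an integral manifold, that is, $b_{*x}(T_xM)=\mathcal D^{\mathfrak s}_{b(x)}$ for all $x\in U$. **Proposition 3.8.** Let $\mathfrak s$ be a symmetry jet on $M$. The 1-jet extension map $\varphi\mapsto j^1\varphi$, $(j^1\varphi)(x)=\varphi_{*x}$, is a bijection from the set of affine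 local diffeomorphisms of $(M,\nabla^{\mathfrak s})$ onto the set of local bisections of $GL(TM)$ that are leaves of $\mathcal D^{\mathfrak s}$, and a local diffeomorphism $\varphi$ is affine if and only if $j^1\varphi$ is a leaf of $\mathcal D^{\mathfrak s}$. Likewise, $\varphi\mapsto j^1\varphi$ is a bijection from the set of affine diffeomorphisms $M\to M$ onto the set of global bisections of $GL(TM)$ that are leaves of $\mathcal D^{\mathfrak s}$. -/

import Mathlib

open Bundle Set
open scoped Manifold ContDiff

namespace AffineJets

noncomputable section

/-! ### Pullback bundles: topological module structure on the fibres -/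

section PullbackInstances

variable {B B' : Type*} (f : B' → B) (V : B → Type*)

instance pullbackAddCommGroup [∀ x, AddCommGroup (V x)] (x : B') :
    AddCommGroup ((f *ᵖ V) x) :=
  inferInstanceAs (AddCommGroup (V (f x)))

instance pullbackIsTopologicalAddGroup [∀ x, AddCommGroup (V x)] [∀ x, TopologicalSpace (V x)]
    [∀ x, IsTopologicalAddGroup (V x)] (x : B') : IsTopologicalAddGroup ((f *ᵖ V) x) :=
  inferInstanceAs (IsTopologicalAddGroup (V (f x)))

instance pullbackContinuousSMul [∀ x, AddCommGroup (V x)] [∀ x, Module ℝ (V x)]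
    [∀ x, TopologicalSpace (V x)] [∀ x, ContinuousSMul ℝ (V x)] (x : B') :
    ContinuousSMul ℝ ((f *ᵖ V) x) :=
  inferInstanceAs (ContinuousSMul ℝ (V (f x)))

end PullbackInstances

variable (E : Type*) [NormedAddCommGroup E] [NormedSpace ℝ E] [FiniteDimensional ℝ E]
  (M : Type*) [TopologicalSpace M] [ChartedSpace E M] [IsManifold 𝓘(ℝ, E) ∞ M]

/-! ### The general linear groupoid `GL(TM)`

`Hom(TM, TM)` is the vector bundle over `M × M` whose fibre at `(y, x)` is the space of linear maps
`T_x M → T_y M`. The groupoid `GL(TM)`, i.e. the space of 1-jets of local diffeomorphisms of `M`,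
is the open submanifold of its total space consisting of the invertible maps; its tangent spaces
are those of the total space. -/

/-- The pullback of `TM` along `(y, x) ↦ x`. -/
abbrev SrcTangent : M × M → Type _ :=
  (ContMDiffMap.snd : C^∞⟮𝓘(ℝ, E).prod 𝓘(ℝ, E), M × M; 𝓘(ℝ, E), M⟯) *ᵖ
    (TangentSpace 𝓘(ℝ, E) : M → Type _)

/-- The pullback of `TM` along `(y, x) ↦ y`. -/
abbrev TgtTangent : M × M → Type _ :=
  (ContMDiffMap.fst : C^∞⟮𝓘(ℝ, E).prod 𝓘(ℝ, E), M × M; 𝓘(ℝ, E), M⟯) *ᵖ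
    (TangentSpace 𝓘(ℝ, E) : M → Type _)

/-- The manifold `Hom(TM, TM)` of all linear maps between tangent spaces of `M`. -/
abbrev HomTM : Type _ :=
  TotalSpace (E →L[ℝ] E) (fun p : M × M => SrcTangent E M p →L[ℝ] TgtTangent E M p)

/-- The model of the manifold `Hom(TM, TM)`. -/
abbrev HomModel := (𝓘(ℝ, E).prod 𝓘(ℝ, E)).prod 𝓘(ℝ, E →L[ℝ] E)

instance homTM_isManifold : IsManifold (HomModel E) ∞ (HomTM E M) := inferInstance

variable {E M}

/-- The source map `α`. -/
def src (ξ : HomTM E M) : M := ξ.proj.2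

/-- The target map `β`. -/
def tgt (ξ : HomTM E M) : M := ξ.proj.1

/-- The linear map `T_x M → T_y M` underlying a point of `Hom(TM, TM)` over `(y, x)`. -/
def toLin (ξ : HomTM E M) :
    TangentSpace 𝓘(ℝ, E) (src ξ) →L[ℝ] TangentSpace 𝓘(ℝ, E) (tgt ξ) := ξ.2

/-- A linear map `T_x M → T_y M` as a point of `Hom(TM, TM)`. -/
def ofLin {x y : M} (L : TangentSpace 𝓘(ℝ, E) x →L[ℝ] TangentSpace 𝓘(ℝ, E) y) : HomTM E M :=
  ⟨(y, x), L⟩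

/-- The differential `α_*` of the source map at `ξ`. -/
def dsrc (ξ : HomTM E M) :
    TangentSpace (HomModel E) ξ →L[ℝ] TangentSpace 𝓘(ℝ, E) (src ξ) :=
  mfderiv (HomModel E) 𝓘(ℝ, E) src ξ

/-- The differential `β_*` of the target map at `ξ`. -/
def dtgt (ξ : HomTM E M) :
    TangentSpace (HomModel E) ξ →L[ℝ] TangentSpace 𝓘(ℝ, E) (tgt ξ) :=
  mfderiv (HomModel E) 𝓘(ℝ, E) tgt ξ

variable (E) in
/-- The point `-I_x` of `GL(TM)`. -/
def negI (x : M) : HomTM E M := ofLin (-(ContinuousLinearMap.id ℝ (TangentSpace 𝓘(ℝ, E) x)))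

/-! ### Local bisections and their 1-jets -/

variable (E M) in
/-- Smooth local diffeomorphisms of `M`: diffeomorphisms between two open subsets of `M`
(the values outside the domain are irrelevant). -/
abbrev LocalDiffeo := PartialDiffeomorph 𝓘(ℝ, E) 𝓘(ℝ, E) M M ∞

/-- Two local diffeomorphisms are the same if they have the same domain and agree on it. -/
def LocalDiffeo.Same (φ ψ : LocalDiffeo E M) : Prop :=
  φ.source = ψ.source ∧ EqOn φ ψ φ.source

variable (E M) in
/-- A local bisection of `GL(TM)`: a smooth section `b` of the source map `α` over an open set `U`,
with invertible values, such that `β ∘ b` is a diffeomorphism from `U` onto an open set `V`. Here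
`base` is `β ∘ b` and `lin x` is `b(x)` (the values outside `U` are irrelevant). -/
structure LocalBisection where
  base : LocalDiffeo E M
  lin : ∀ x : M, TangentSpace 𝓘(ℝ, E) x →L[ℝ] TangentSpace 𝓘(ℝ, E) (base x)
  isInvertible : ∀ x ∈ base.source, (lin x).IsInvertible
  contMDiffOn : ContMDiffOn 𝓘(ℝ, E) (HomModel E) ∞ (fun x => ofLin (lin x)) base.source

namespace LocalBisection

/-- The domain `U` of a local bisection. -/
def source (b : LocalBisection E M) : Set M := b.base.source

/-- The set `V = β(b(U))`. -/
def target (b : LocalBisection E M) : Set M := b.base.target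

/-- The section `x ↦ b(x)`. -/
def toSection (b : LocalBisection E M) (x : M) : HomTM E M := ofLin (b.lin x)

/-- The differential `b_{*x} : T_x M → T_{b(x)} GL(TM)`. -/
def deriv (b : LocalBisection E M) (x : M) :
    TangentSpace 𝓘(ℝ, E) x →L[ℝ] TangentSpace (HomModel E) (b.toSection x) :=
  mfderiv 𝓘(ℝ, E) (HomModel E) b.toSection x

/-- Two local bisections are the same if they have the same domain and agree on it. -/
def Same (b b' : LocalBisection E M) : Prop :=
  b.source = b'.source ∧ EqOn b.toSection b'.toSection b.source

open Classical in
/-- The local vector field `b(Y)`, with value `b(x) Y_x` at the point `y = β(b(x))`. It lives on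
`V`, and is extended by zero outside `V`. -/
def pushforward (b : LocalBisection E M) (Y : ∀ x : M, TangentSpace 𝓘(ℝ, E) x) (y : M) :
    TangentSpace 𝓘(ℝ, E) y :=
  if h : y ∈ b.base.target then
    (b.base.right_inv h) ▸
      (b.lin (b.base.toPartialEquiv.symm y) (Y (b.base.toPartialEquiv.symm y)))
  else 0

end LocalBisection

variable (E M) in
/-- The data of the 1-jet `j¹_x b` of a local bisection `b` of `GL(TM)` is that of the point `b(x)`
and of the linear map `b_{*x} : T_x M → T_{b(x)} GL(TM)`. -/
abbrev PreJet : Type _ :=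
  Σ ξ : HomTM E M, TangentSpace 𝓘(ℝ, E) (src ξ) →L[ℝ] TangentSpace (HomModel E) ξ

/-- The `(1,1)`-jet `j¹_x b`. -/
def LocalBisection.jet (b : LocalBisection E M) (x : M) : PreJet E M :=
  ⟨b.toSection x, b.deriv x⟩

/-- The 1-jet extension `j¹φ : x ↦ φ_{*x}` of a local diffeomorphism, as a local bisection. -/
def j1 (φ : LocalDiffeo E M) : LocalBisection E M where
  base := φ
  lin x := mfderiv 𝓘(ℝ, E) 𝓘(ℝ, E) φ x
  isInvertible x hx :=
    ⟨(φ.isLocalDiffeomorphAt _ _ _ hx).mfderivToContinuousLinearEquiv (by simp),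
      IsLocalDiffeomorphAt.mfderivToContinuousLinearEquiv_coe _ _⟩
  contMDiffOn := by
    intro x hx
    have h := φ.contMDiffOn_toFun.contMDiffAt (φ.open_source.mem_nhds hx)
    apply ContMDiffAt.contMDiffWithinAt
    rw [contMDiffAt_hom_bundle]
    refine ⟨h.prodMk contMDiffAt_id, ?_⟩
    refine (h.mfderiv_const (m := ∞) (by decide)).congr_of_eventuallyEq ?_
    have h1 := (trivializationAt E (TangentSpace 𝓘(ℝ, E)) x).open_baseSet.mem_nhds
      (mem_baseSet_trivializationAt E (TangentSpace 𝓘(ℝ, E)) x)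
    have h2 := h.continuousAt.preimage_mem_nhds
      ((trivializationAt E (TangentSpace 𝓘(ℝ, E)) (φ x)).open_baseSet.mem_nhds
        (mem_baseSet_trivializationAt E (TangentSpace 𝓘(ℝ, E)) (φ x)))
    filter_upwards [h1, h2] with x' h1 h2
    unfold inTangentCoordinates
    rw [ContinuousLinearMap.inCoordinates_eq (by exact h1) (by exact h2),
      ContinuousLinearMap.inCoordinates_eq (by exact h1) (by exact h2)]
    apply ContinuousLinearMap.ext
    intro v
    simp only [ContinuousLinearMap.comp_apply]
    refine congrArg (fun w : TangentSpace 𝓘(ℝ, E) x' =>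
      (trivializationAt E (TangentSpace 𝓘(ℝ, E)) (φ x)).continuousLinearEquivAt ℝ (φ x') h2
        (mfderiv 𝓘(ℝ, E) 𝓘(ℝ, E) φ x' w)) ?_
    refine ((trivializationAt E (TangentSpace 𝓘(ℝ, E)) x).continuousLinearEquivAt ℝ x' h1).injective ?_
    refine Eq.trans ?_ (ContinuousLinearEquiv.apply_symm_apply _ _).symm
    exact ContinuousLinearEquiv.apply_symm_apply
      ((trivializationAt E (SrcTangent E M) (φ x, x)).continuousLinearEquivAt ℝ (φ x', x') h1) v

/-! ### Symmetry jets and the induced connection -/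

variable (E M) in
/-- A symmetry jet: a smooth section `x ↦ 𝔰(x) = j¹_x s_x` of the bundle of semi-holonomic
`(1,1)`-jets (1-jets of local bisections of `GL(TM)` with `p = p_*`) whose first order part is
`-I`. The jet `𝔰(x)` is the pair `(-I_x, lin x)`; thus `p(𝔰(x)) = -I_x` holds by construction, and
`p_*(𝔰(x))`, the 1-jet at `x` of `β ∘ s_x`, is `β_* ∘ lin x`. Smoothness of the section is
smoothness of the bundle map `TM → T GL(TM)` that it defines. -/
structure SymmetryJet where
  lin : ∀ x : M, TangentSpace 𝓘(ℝ, E) x →L[ℝ] TangentSpace (HomModel E) (negI E x)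
  exists_rep : ∀ x : M, ∃ s : LocalBisection E M,
    x ∈ s.source ∧ s.jet x = (⟨negI E x, lin x⟩ : PreJet E M)
  pStar_eq : ∀ (x : M) (X : TangentSpace 𝓘(ℝ, E) x), dtgt (negI E x) (lin x X) = -X
  contMDiff : ContMDiff (𝓘(ℝ, E).prod 𝓘(ℝ, E)) ((HomModel E).prod 𝓘(ℝ, (E × E) × (E →L[ℝ] E))) ∞
    (fun v : TangentBundle 𝓘(ℝ, E) M =>
      (⟨negI E v.proj, lin v.proj v.2⟩ : TangentBundle (HomModel E) (HomTM E M)))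

namespace SymmetryJet

variable (𝔰 : SymmetryJet E M)

/-- A local bisection `s_x` with `𝔰(x) = j¹_x s_x`. -/
def rep (x : M) : LocalBisection E M := (𝔰.exists_rep x).choose

/-- The affine connection `∇^𝔰`, given by `(∇_X Y)_x = ½ [X, Y + s_x(Y)]_x`. -/
def connection (X Y : ∀ x : M, TangentSpace 𝓘(ℝ, E) x) (x : M) : TangentSpace 𝓘(ℝ, E) x :=
  (1 / 2 : ℝ) • VectorField.mlieBracket 𝓘(ℝ, E) X (Y + (𝔰.rep x).pushforward Y) x

/-- A local diffeomorphism `φ : U → V` is affine if `φ_*(∇_X Y) = ∇_{φ_* X} φ_* Y` for all smooth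
vector fields `X`, `Y` on `U`; here `φ_* X` is the pullback of `X` by `φ⁻¹`. -/
def IsAffine (φ : LocalDiffeo E M) : Prop :=
  ∀ X Y : ∀ x : M, TangentSpace 𝓘(ℝ, E) x,
    ContMDiffOn 𝓘(ℝ, E) (𝓘(ℝ, E).prod 𝓘(ℝ, E)) ∞
      (fun x => (⟨x, X x⟩ : TangentBundle 𝓘(ℝ, E) M)) φ.source →
    ContMDiffOn 𝓘(ℝ, E) (𝓘(ℝ, E).prod 𝓘(ℝ, E)) ∞
      (fun x => (⟨x, Y x⟩ : TangentBundle 𝓘(ℝ, E) M)) φ.source →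
    ∀ x ∈ φ.source,
      mfderiv 𝓘(ℝ, E) 𝓘(ℝ, E) φ x (𝔰.connection X Y x) =
        𝔰.connection (VectorField.mpullback 𝓘(ℝ, E) 𝓘(ℝ, E) φ.symm X)
          (VectorField.mpullback 𝓘(ℝ, E) 𝓘(ℝ, E) φ.symm Y) (φ x)

end SymmetryJet

/-! ### The affine distribution -/

/-- The velocity at time `0` of a curve in `Hom(TM, TM)`. -/
def velocity (c : ℝ → HomTM E M) : TangentBundle (HomModel E) (HomTM E M) :=
  ⟨c 0, mfderiv 𝓘(ℝ, ℝ) (HomModel E) c 0 (1 : ℝ)⟩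

/-- The graph of the differential `m_*(X₂, X₁) = X₂ · X₁` of the groupoid multiplication:
`X₂ · X₁ = W` if there are smooth curves `c₂`, `c₁`, with `α(c₂(t)) = β(c₁(t))` for all `t`, whose
velocities at `0` are `X₂` and `X₁`, such that `W` is the velocity at `0` of
`t ↦ c₂(t) · c₁(t)`. -/
def IsTangentMul (X₂ X₁ W : TangentBundle (HomModel E) (HomTM E M)) : Prop :=
  ∃ (x y z : ℝ → M)
    (c₁ : ∀ t, TangentSpace 𝓘(ℝ, E) (x t) →L[ℝ] TangentSpace 𝓘(ℝ, E) (y t))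
    (c₂ : ∀ t, TangentSpace 𝓘(ℝ, E) (y t) →L[ℝ] TangentSpace 𝓘(ℝ, E) (z t)),
    ContMDiffAt 𝓘(ℝ, ℝ) (HomModel E) ∞ (fun t => ofLin (c₁ t)) 0 ∧
    ContMDiffAt 𝓘(ℝ, ℝ) (HomModel E) ∞ (fun t => ofLin (c₂ t)) 0 ∧
    velocity (fun t => ofLin (c₁ t)) = X₁ ∧
    velocity (fun t => ofLin (c₂ t)) = X₂ ∧
    velocity (fun t => ofLin (c₂ t ∘L c₁ t)) = W

/-- The holonomic distribution `ℰ` on `GL(TM)`: with `p = (β, α)` the projection to `M × M`, it is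
`ℰ_ξ = p_*⁻¹ {(ξ X, X)}`. -/
def holonomicDistribution (ξ : HomTM E M) : Set (TangentSpace (HomModel E) ξ) :=
  {v | dtgt ξ v = toLin ξ (dsrc ξ v)}

namespace SymmetryJet

variable (𝔰 : SymmetryJet E M)

/-- The graph of the map `ψ_ξ : T_ξ GL(TM) → T_ξ GL(TM)`, `ξ : T_x M → T_y M`, which sends `v`
to `w = Ȳ · v · X̄`, where `X̄` is the lift of `α_* v` via `β_*` in the plane `D(𝔰(x)) = im (lin x)`,
and `Ȳ` is the lift of `β_* v` via `α_*` in `D(𝔰(y))`. -/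
def IsPsi (ξ : HomTM E M) (v w : TangentSpace (HomModel E) ξ) : Prop :=
  ∃ (u : TangentSpace 𝓘(ℝ, E) (src ξ)) (u' : TangentSpace 𝓘(ℝ, E) (tgt ξ))
    (W : TangentBundle (HomModel E) (HomTM E M)),
    dtgt (negI E (src ξ)) (𝔰.lin (src ξ) u) = dsrc ξ v ∧
    dsrc (negI E (tgt ξ)) (𝔰.lin (tgt ξ) u') = dtgt ξ v ∧
    IsTangentMul ⟨ξ, v⟩ ⟨negI E (src ξ), 𝔰.lin (src ξ) u⟩ W ∧
    IsTangentMul ⟨negI E (tgt ξ), 𝔰.lin (tgt ξ) u'⟩ W ⟨ξ, w⟩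

/-- The affine distribution `𝒟^𝔰`: `𝒟_ξ` is the intersection of the `(-1)`-eigenspace of `ψ_ξ`
with `ℰ_ξ`. -/
def affineDistribution (ξ : HomTM E M) : Set (TangentSpace (HomModel E) ξ) :=
  {v | 𝔰.IsPsi ξ v (-v)} ∩ holonomicDistribution ξ

/-- A local bisection `b : U → GL(TM)` is a leaf (an integral manifold) of `𝒟^𝔰` if the tangent
space `b_{*x}(T_x M)` of the submanifold `b(U)` at `b(x)` is `𝒟_{b(x)}`, for all `x ∈ U`. -/
def IsLeaf (b : LocalBisection E M) : Prop :=
  ∀ x ∈ b.source, range (b.deriv x) = 𝔰.affineDistribution (b.toSection x)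

end SymmetryJet

end

end AffineJets

open Bundle Set
open scoped Manifold ContDiff

namespace AffineJets

noncomputable section

set_option linter.unusedSectionVars false

variable {E : Type*} [NormedAddCommGroup E] [NormedSpace ℝ E] [FiniteDimensional ℝ E]
  {M : Type*} [TopologicalSpace M] [ChartedSpace E M] [IsManifold 𝓘(ℝ, E) ∞ M]

/-! Everything is pointwise, so the proof reads each object in the preferred charts at the points
concerned, where tangent spaces are the model space `E` itself. A tangent vector to `Hom(TM, TM)` at
`A : T_x M → T_y M` becomes a triple `((b, a), P)`: the velocities of target and source, and the
derivative of the matrix. The symmetry jet becomes `X ↦ ((-X, X), S_x X)`, where `S_x` is bilinear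
(`SymmetryJet.linDeriv`).

The differential of multiplication is the product rule (`isTangentMul_iff`). Multiplying on both
sides by lifts at `-I` gives `ψ ((b, a), P) = ((-b, -a), P + A S_x(a) - S_y(b) A)`, so the affine
distribution is cut out by `b = A a` and `2 P = S_y(A a) A - A S_x(a)`
(`mem_affineDistribution_iff`). Expanding the bracket gives `∇_X Y = DY(X) - ½ S_x(X, Y)`
(`connection_eq`).

Transporting this formula by `φ`, the terms in `DY` cancel, and `φ` is affine iff `2 D²φ(X, Y) =
S(Dφ X, Dφ Y) - Dφ S(X, Y)` (`isAffine_iff`). This is the second leaf equation for `j1 φ`; the first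
is automatic there. For an arbitrary bisection `b` the first leaf equation says `(β ∘ b)_* = b`, so
a leaf is the 1-jet extension of its base map (`isLeaf_iff`, `j1_base_same`). -/

/-! ### Coordinates on `TM` and `Hom(TM, TM)` in the preferred charts. -/

/-- The coordinates of tangent vectors at `x` in the preferred chart at `x₀`. -/
def chartCoord (x₀ x : M) : TangentSpace 𝓘(ℝ, E) x →L[ℝ] E :=
  (trivializationAt E (TangentSpace 𝓘(ℝ, E)) x₀).continuousLinearMapAt ℝ x

/-- The tangent vector at `x` with given coordinates in the preferred chart at `x₀`. -/
def chartVec (x₀ x : M) : E →L[ℝ] TangentSpace 𝓘(ℝ, E) x :=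
  (trivializationAt E (TangentSpace 𝓘(ℝ, E)) x₀).symmL ℝ x

lemma chartCoord_chartVec {x₀ x : M} (hx : x ∈ (chartAt E x₀).source) (v : E) :
    chartCoord x₀ x (chartVec x₀ x v) = v :=
  (trivializationAt E (TangentSpace 𝓘(ℝ, E)) x₀).continuousLinearMapAt_symmL hx v

lemma chartVec_chartCoord {x₀ x : M} (hx : x ∈ (chartAt E x₀).source)
    (v : TangentSpace 𝓘(ℝ, E) x) : chartVec x₀ x (chartCoord x₀ x v) = v :=
  (trivializationAt E (TangentSpace 𝓘(ℝ, E)) x₀).symmL_continuousLinearMapAt hx v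

/-- The fibre `T_x M` is the model space by way of the chart at `x`, so the coordinate change is
trivial. This justifies treating vectors at `x` as elements of `E`. -/
lemma chartCoord_self (x : M) (v : TangentSpace 𝓘(ℝ, E) x) : chartCoord x x v = v := by
  unfold chartCoord
  rw [TangentBundle.continuousLinearMapAt_trivializationAt_eq_core (by simp)]
  exact (tangentBundleCore 𝓘(ℝ, E) M).coordChange_self _ _ (by simp) v

lemma chartVec_self (x : M) (v : E) : chartVec x x v = v := by
  rw [← chartCoord_self x (chartVec x x v)]
  exact chartCoord_chartVec (by simp) v

lemma eventually_mem_chartAt_source (x₀ : M) :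
    ∀ᶠ x in nhds x₀, x ∈ (chartAt E x₀).source :=
  (chartAt E x₀).open_source.mem_nhds (mem_chart_source E x₀)

/-- The coordinates of a linear map `T_x M → T_y M`, in the preferred charts at the components of
`p₀`. -/
def fibreCoord (p₀ : M × M) (ξ : HomTM E M) : E →L[ℝ] E :=
  (trivializationAt (E →L[ℝ] E) (fun p : M × M => SrcTangent E M p →L[ℝ] TgtTangent E M p) p₀ ξ).2

lemma fibreCoord_ofLin {x₀ y₀ x y : M} (hx : x ∈ (chartAt E x₀).source)
    (hy : y ∈ (chartAt E y₀).source) (L : TangentSpace 𝓘(ℝ, E) x →L[ℝ] TangentSpace 𝓘(ℝ, E) y)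
    (v : E) :
    fibreCoord (y₀, x₀) (ofLin L) v = chartCoord y₀ y (L (chartVec x₀ x v)) := by
  refine (DFunLike.congr_fun (ContinuousLinearMap.inCoordinates_eq (F := E) (F' := E)
    (E := SrcTangent E M) (E' := TgtTangent E M) (x₀ := (y₀, x₀)) (x := (y, x)) (y₀ := (y₀, x₀))
    (y := (y, x)) (ϕ := L)
    (by exact hx) (by exact hy)) v).trans ?_
  have h1 : chartVec x₀ x v = ((trivializationAt E (SrcTangent E M)
      (y₀, x₀)).continuousLinearEquivAt ℝ (y, x) hx).symm v := by
    refine ((trivializationAt E (TangentSpace 𝓘(ℝ, E)) x₀).continuousLinearEquivAt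
      ℝ x hx).injective ?_
    refine Eq.trans ?_ (ContinuousLinearEquiv.apply_symm_apply
      ((trivializationAt E (SrcTangent E M) (y₀, x₀)).continuousLinearEquivAt ℝ (y, x) hx) v).symm
    refine Eq.trans ?_ (chartCoord_chartVec hx v)
    exact ((trivializationAt E (TangentSpace 𝓘(ℝ, E)) x₀).continuousLinearMapAt_apply_of_mem
      ℝ hx _).symm
  rw [h1]
  exact ((trivializationAt E (TangentSpace 𝓘(ℝ, E)) y₀).continuousLinearMapAt_apply_of_mem
      ℝ hy _).symm

lemma fibreCoord_self {x y : M} (L : TangentSpace 𝓘(ℝ, E) x →L[ℝ] TangentSpace 𝓘(ℝ, E) y) (v : E) :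
    fibreCoord (y, x) (ofLin L) v = L v := by
  rw [fibreCoord_ofLin (mem_chart_source E x) (mem_chart_source E y) L, chartCoord_self,
    chartVec_self]

/-- Reading the components of a map in the charts at the base point therefore introduces no
correction to its derivative. -/
lemma hasMFDerivAt_extChartAt_self {F H N : Type*} [NormedAddCommGroup F] [NormedSpace ℝ F]
    [TopologicalSpace H] {I : ModelWithCorners ℝ F H} [TopologicalSpace N] [ChartedSpace H N]
    [IsManifold I 1 N] (x : N) :
    HasMFDerivAt I 𝓘(ℝ, F) (extChartAt I x) x (ContinuousLinearMap.id ℝ F) := by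
  have h := (mdifferentiableAt_extChartAt (I := I) (mem_chart_source H x)).hasMFDerivAt
  exact h.congr_mfderiv mfderiv_extChartAt_self

lemma mdifferentiableAt_tgt (ξ : HomTM E M) :
    MDifferentiableAt (HomModel E) 𝓘(ℝ, E) (tgt : HomTM E M → M) ξ :=
  (mdifferentiableAt_fst (x := ξ.proj)).comp ξ (Bundle.mdifferentiableAt_proj _)

lemma mdifferentiableAt_src (ξ : HomTM E M) :
    MDifferentiableAt (HomModel E) 𝓘(ℝ, E) (src : HomTM E M → M) ξ :=
  (mdifferentiableAt_snd (x := ξ.proj)).comp ξ (Bundle.mdifferentiableAt_proj _)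

lemma extChartAt_homTM (ξ₀ ξ : HomTM E M) :
    extChartAt (HomModel E) ξ₀ ξ =
      ((extChartAt 𝓘(ℝ, E) (tgt ξ₀) (tgt ξ), extChartAt 𝓘(ℝ, E) (src ξ₀) (src ξ)),
        fibreCoord ξ₀.proj ξ) := by
  rw [FiberBundle.extChartAt]
  rfl

lemma hasMFDerivAt_fibreCoord (ξ : HomTM E M) :
    HasMFDerivAt (HomModel E) 𝓘(ℝ, E →L[ℝ] E) (fibreCoord ξ.proj) ξ
      (ContinuousLinearMap.snd ℝ (E × E) (E →L[ℝ] E)) := by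
  have h := ((ContinuousLinearMap.snd ℝ (E × E) (E →L[ℝ] E)).hasMFDerivAt
    (x := extChartAt (HomModel E) ξ ξ)).comp ξ (hasMFDerivAt_extChartAt_self ξ)
  refine h.congr_of_eventuallyEq (Filter.Eventually.of_forall fun ξ' => ?_)
  exact (congrArg Prod.snd (extChartAt_homTM ξ ξ')).symm

lemma dtgt_apply (ξ : HomTM E M) (v : (E × E) × (E →L[ℝ] E)) : dtgt ξ v = v.1.1 := by
  have h := ((ContinuousLinearMap.fst ℝ E E ∘L
    ContinuousLinearMap.fst ℝ (E × E) (E →L[ℝ] E)).hasMFDerivAt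
    (x := extChartAt (HomModel E) ξ ξ)).comp ξ (hasMFDerivAt_extChartAt_self ξ)
  have h' := (hasMFDerivAt_extChartAt_self (I := 𝓘(ℝ, E)) (tgt ξ)).comp ξ
    (mdifferentiableAt_tgt ξ).hasMFDerivAt
  have he := hasMFDerivAt_unique (h'.congr_of_eventuallyEq (f₁ := fun ξ' =>
    (extChartAt (HomModel E) ξ ξ').1.1) (Filter.Eventually.of_forall fun ξ' =>
      congrArg (fun p => p.1.1) (extChartAt_homTM ξ ξ'))) h
  exact DFunLike.congr_fun he v

lemma dsrc_apply (ξ : HomTM E M) (v : (E × E) × (E →L[ℝ] E)) : dsrc ξ v = v.1.2 := by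
  have h := ((ContinuousLinearMap.snd ℝ E E ∘L
    ContinuousLinearMap.fst ℝ (E × E) (E →L[ℝ] E)).hasMFDerivAt
    (x := extChartAt (HomModel E) ξ ξ)).comp ξ (hasMFDerivAt_extChartAt_self ξ)
  have h' := (hasMFDerivAt_extChartAt_self (I := 𝓘(ℝ, E)) (src ξ)).comp ξ
    (mdifferentiableAt_src ξ).hasMFDerivAt
  have he := hasMFDerivAt_unique (h'.congr_of_eventuallyEq (f₁ := fun ξ' =>
    (extChartAt (HomModel E) ξ ξ').1.2) (Filter.Eventually.of_forall fun ξ' =>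
      congrArg (fun p => p.1.2) (extChartAt_homTM ξ ξ'))) h
  exact DFunLike.congr_fun he v

lemma contMDiffAt_homTM_iff {F H N : Type*} [NormedAddCommGroup F] [NormedSpace ℝ F]
    [TopologicalSpace H] {I : ModelWithCorners ℝ F H} [TopologicalSpace N] [ChartedSpace H N]
    {g : N → HomTM E M} {n₀ : N} :
    ContMDiffAt I (HomModel E) ∞ g n₀ ↔
      (ContMDiffAt I 𝓘(ℝ, E) ∞ (fun n => tgt (g n)) n₀ ∧
        ContMDiffAt I 𝓘(ℝ, E) ∞ (fun n => src (g n)) n₀) ∧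
      ContMDiffAt I 𝓘(ℝ, E →L[ℝ] E) ∞ (fun n => fibreCoord (g n₀).proj (g n)) n₀ :=
  Bundle.contMDiffAt_totalSpace.trans (and_congr_left' (contMDiffAt_prod_iff _))

/-- The components of the derivative of a map to `Hom(TM, TM)`. -/
lemma mfderiv_homTM_apply {F H N : Type*} [NormedAddCommGroup F] [NormedSpace ℝ F]
    [TopologicalSpace H] {I : ModelWithCorners ℝ F H} [TopologicalSpace N] [ChartedSpace H N]
    {g : N → HomTM E M} {n₀ : N} (hg : MDifferentiableAt I (HomModel E) g n₀)
    (v : TangentSpace I n₀) :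
    mfderiv I (HomModel E) g n₀ v =
      (((mfderiv I 𝓘(ℝ, E) (fun n => tgt (g n)) n₀ v, mfderiv I 𝓘(ℝ, E) (fun n => src (g n)) n₀ v),
        mfderiv I 𝓘(ℝ, E →L[ℝ] E) (fun n => fibreCoord (g n₀).proj (g n)) n₀ v) :
          (E × E) × (E →L[ℝ] E)) := by
  have h1 := ((mdifferentiableAt_tgt (g n₀)).hasMFDerivAt.comp n₀ hg.hasMFDerivAt).mfderiv
  have h2 := ((mdifferentiableAt_src (g n₀)).hasMFDerivAt.comp n₀ hg.hasMFDerivAt).mfderiv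
  have h3 := ((hasMFDerivAt_fibreCoord (g n₀)).comp n₀ hg.hasMFDerivAt).mfderiv
  refine Prod.ext (Prod.ext ?_ ?_) ?_
  · exact ((DFunLike.congr_fun h1 v).trans (dtgt_apply _ _)).symm
  · exact ((DFunLike.congr_fun h2 v).trans (dsrc_apply _ _)).symm
  · exact (DFunLike.congr_fun h3 v).symm

/-! ### The differential of the groupoid multiplication. -/

/-- All tangent spaces unfold to one model space, so vectors can be compared without transport along
the equality of base points. -/
lemma tangentBundle_homTM_ext {p q : TangentBundle (HomModel E) (HomTM E M)} (h : p.proj = q.proj)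
    (h' : (p.2 : (E × E) × (E →L[ℝ] E)) = q.2) : p = q := by
  obtain ⟨ξ, v⟩ := p
  obtain ⟨ξ', v'⟩ := q
  obtain rfl : ξ = ξ' := h
  exact congrArg (Bundle.TotalSpace.mk ξ) h'

lemma tgt_ofLin {x y : M} (L : TangentSpace 𝓘(ℝ, E) x →L[ℝ] TangentSpace 𝓘(ℝ, E) y) :
    tgt (ofLin L) = y := rfl

lemma src_ofLin {x y : M} (L : TangentSpace 𝓘(ℝ, E) x →L[ℝ] TangentSpace 𝓘(ℝ, E) y) :
    src (ofLin L) = x := rfl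

lemma ofLin_comp_congr {x y z x' y' z' : M}
    {A : TangentSpace 𝓘(ℝ, E) x →L[ℝ] TangentSpace 𝓘(ℝ, E) y}
    {B : TangentSpace 𝓘(ℝ, E) y →L[ℝ] TangentSpace 𝓘(ℝ, E) z}
    {A' : TangentSpace 𝓘(ℝ, E) x' →L[ℝ] TangentSpace 𝓘(ℝ, E) y'}
    {B' : TangentSpace 𝓘(ℝ, E) y' →L[ℝ] TangentSpace 𝓘(ℝ, E) z'}
    (hA : ofLin A = ofLin A') (hB : ofLin B = ofLin B') :
    ofLin (B ∘L A) = ofLin (B' ∘L A') := by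
  obtain rfl : x = x' := congrArg src hA
  obtain rfl : y = y' := congrArg tgt hA
  obtain rfl : z = z' := congrArg tgt hB
  obtain rfl : A = A' := Bundle.TotalSpace.mk_injective (y, x) hA
  obtain rfl : B = B' := Bundle.TotalSpace.mk_injective (z, y) hB
  rfl

lemma fibreCoord_comp {x₀ y₀ z₀ x y z : M} (hx : x ∈ (chartAt E x₀).source)
    (hy : y ∈ (chartAt E y₀).source) (hz : z ∈ (chartAt E z₀).source)
    (A : TangentSpace 𝓘(ℝ, E) x →L[ℝ] TangentSpace 𝓘(ℝ, E) y)
    (B : TangentSpace 𝓘(ℝ, E) y →L[ℝ] TangentSpace 𝓘(ℝ, E) z) :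
    fibreCoord (z₀, x₀) (ofLin (B ∘L A)) =
      fibreCoord (z₀, y₀) (ofLin B) ∘L fibreCoord (y₀, x₀) (ofLin A) := by
  ext v
  rw [fibreCoord_ofLin hx hz, ContinuousLinearMap.comp_apply, ContinuousLinearMap.comp_apply,
    fibreCoord_ofLin hx hy, fibreCoord_ofLin hy hz, chartVec_chartCoord hy]

/-- A linear map between tangent spaces, as an endomorphism of the model space. -/
def modelLin {x y : M} (L : TangentSpace 𝓘(ℝ, E) x →L[ℝ] TangentSpace 𝓘(ℝ, E) y) : E →L[ℝ] E := L

lemma fibreCoord_eq_modelLin {x y : M}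
    (L : TangentSpace 𝓘(ℝ, E) x →L[ℝ] TangentSpace 𝓘(ℝ, E) y) :
    fibreCoord (y, x) (ofLin L) = modelLin L :=
  ContinuousLinearMap.ext (fibreCoord_self L)

lemma fderiv_comp_apply_one {f g : ℝ → E →L[ℝ] E} (hf : DifferentiableAt ℝ f 0)
    (hg : DifferentiableAt ℝ g 0) :
    fderiv ℝ (fun t => g t ∘L f t) 0 1 = fderiv ℝ g 0 1 ∘L f 0 + g 0 ∘L fderiv ℝ f 0 1 := by
  simpa only [fderiv_apply_one_eq_deriv] using (hg.hasDerivAt.clm_comp hf.hasDerivAt).deriv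

/-- The curves defining the differential of the multiplication have the velocities given by the
product rule. -/
lemma velocity_comp {x y z : ℝ → M}
    {c₁ : ∀ t, TangentSpace 𝓘(ℝ, E) (x t) →L[ℝ] TangentSpace 𝓘(ℝ, E) (y t)}
    {c₂ : ∀ t, TangentSpace 𝓘(ℝ, E) (y t) →L[ℝ] TangentSpace 𝓘(ℝ, E) (z t)}
    (h₁ : ContMDiffAt 𝓘(ℝ, ℝ) (HomModel E) ∞ (fun t => ofLin (c₁ t)) 0)
    (h₂ : ContMDiffAt 𝓘(ℝ, ℝ) (HomModel E) ∞ (fun t => ofLin (c₂ t)) 0)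
    {x₀ y₀ z₀ : M} {A : TangentSpace 𝓘(ℝ, E) x₀ →L[ℝ] TangentSpace 𝓘(ℝ, E) y₀}
    {B : TangentSpace 𝓘(ℝ, E) y₀ →L[ℝ] TangentSpace 𝓘(ℝ, E) z₀}
    {X₁ X₂ : (E × E) × (E →L[ℝ] E)}
    (hX₁ : velocity (fun t => ofLin (c₁ t)) = ⟨ofLin A, X₁⟩)
    (hX₂ : velocity (fun t => ofLin (c₂ t)) = ⟨ofLin B, X₂⟩) :
    X₂.1.2 = X₁.1.1 ∧ velocity (fun t => ofLin (c₂ t ∘L c₁ t)) = ⟨ofLin (B ∘L A),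
      (((X₂.1.1, X₁.1.2), X₂.2 ∘L modelLin A + modelLin B ∘L X₁.2) :
        (E × E) × (E →L[ℝ] E))⟩ := by
  have p₁ : ofLin (c₁ 0) = ofLin A := congrArg Bundle.TotalSpace.proj hX₁
  have p₂ : ofLin (c₂ 0) = ofLin B := congrArg Bundle.TotalSpace.proj hX₂
  have v₁ : (mfderiv 𝓘(ℝ, ℝ) (HomModel E) (fun t => ofLin (c₁ t)) 0 (1 : ℝ) :
      (E × E) × (E →L[ℝ] E)) = X₁ :=
    congrArg (fun p : TangentBundle (HomModel E) (HomTM E M) => (p.2 : (E × E) × (E →L[ℝ] E))) hX₁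
  have v₂ : (mfderiv 𝓘(ℝ, ℝ) (HomModel E) (fun t => ofLin (c₂ t)) 0 (1 : ℝ) :
      (E × E) × (E →L[ℝ] E)) = X₂ :=
    congrArg (fun p : TangentBundle (HomModel E) (HomTM E M) => (p.2 : (E × E) × (E →L[ℝ] E))) hX₂
  have hx : x 0 = x₀ := congrArg src p₁
  have hy : y 0 = y₀ := congrArg tgt p₁
  have hz : z 0 = z₀ := congrArg tgt p₂
  have q₁ := contMDiffAt_homTM_iff.1 h₁
  have q₂ := contMDiffAt_homTM_iff.1 h₂
  rw [p₁] at q₁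
  rw [p₂] at q₂
  obtain ⟨⟨cy, cx⟩, cA⟩ := q₁
  obtain ⟨⟨cz, -⟩, cB⟩ := q₂
  -- Near `0` the intermediate chart cancels, so multiplication becomes composition in `E →L[ℝ] E`
  -- and the ordinary product rule applies.
  have ev : ∀ᶠ t in nhds (0 : ℝ), fibreCoord (z₀, x₀) (ofLin (c₂ t ∘L c₁ t)) =
      fibreCoord (z₀, y₀) (ofLin (c₂ t)) ∘L fibreCoord (y₀, x₀) (ofLin (c₁ t)) := by
    have ex := cx.continuousAt.eventually (eventually_mem_chartAt_source (E := E) _)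
    have ey := cy.continuousAt.eventually (eventually_mem_chartAt_source (E := E) _)
    have ez := cz.continuousAt.eventually (eventually_mem_chartAt_source (E := E) _)
    simp only [src_ofLin, tgt_ofLin, hx, hy, hz] at ex ey ez
    filter_upwards [ex, ey, ez] with t hx hy hz
    exact fibreCoord_comp hx hy hz _ _
  have p : ofLin (c₂ 0 ∘L c₁ 0) = ofLin (B ∘L A) := ofLin_comp_congr p₁ p₂
  have hcomp : ContMDiffAt 𝓘(ℝ, ℝ) (HomModel E) ∞ (fun t => ofLin (c₂ t ∘L c₁ t)) 0 := by
    refine contMDiffAt_homTM_iff.2 ⟨⟨cz, cx⟩, ?_⟩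
    rw [p]
    exact (cB.clm_comp cA).congr_of_eventuallyEq ev
  have w₁ := mfderiv_homTM_apply (h₁.mdifferentiableAt (by simp)) (1 : ℝ)
  have w₂ := mfderiv_homTM_apply (h₂.mdifferentiableAt (by simp)) (1 : ℝ)
  have w := mfderiv_homTM_apply (hcomp.mdifferentiableAt (by simp)) (1 : ℝ)
  rw [p₁] at w₁
  rw [p₂] at w₂
  rw [p] at w
  have hd : mfderiv 𝓘(ℝ, ℝ) 𝓘(ℝ, E →L[ℝ] E)
      (fun t => fibreCoord (z₀, x₀) (ofLin (c₂ t ∘L c₁ t))) 0 (1 : ℝ) =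
      X₂.2 ∘L modelLin A + modelLin B ∘L X₁.2 := by
    have e₁ : fderiv ℝ (fun t => fibreCoord (y₀, x₀) (ofLin (c₁ t))) 0 1 = X₁.2 := by
      rw [← v₁, ← mfderiv_eq_fderiv]
      exact (congrArg (fun p : (E × E) × (E →L[ℝ] E) => p.2) w₁).symm
    have e₂ : fderiv ℝ (fun t => fibreCoord (z₀, y₀) (ofLin (c₂ t))) 0 1 = X₂.2 := by
      rw [← v₂, ← mfderiv_eq_fderiv]
      exact (congrArg (fun p : (E × E) × (E →L[ℝ] E) => p.2) w₂).symm
    have d := fderiv_comp_apply_one (f := fun t => fibreCoord (y₀, x₀) (ofLin (c₁ t)))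
      (g := fun t => fibreCoord (z₀, y₀) (ofLin (c₂ t))) (cA.mdifferentiableAt (by simp)).differentiableAt
      (cB.mdifferentiableAt (by simp)).differentiableAt
    rw [mfderiv_eq_fderiv, Filter.EventuallyEq.fderiv_eq ev]
    refine d.trans ?_
    rw [e₁, e₂, p₁, p₂]
    congr 2 <;> exact fibreCoord_eq_modelLin _
  refine ⟨?_, tangentBundle_homTM_ext p ?_⟩
  · rw [← v₁, ← v₂]
    exact (congrArg (fun p : (E × E) × (E →L[ℝ] E) => p.1.2) w₂).trans
      (congrArg (fun p : (E × E) × (E →L[ℝ] E) => p.1.1) w₁).symm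
  · refine w.trans (Prod.ext (Prod.ext ?_ ?_) hd)
    · rw [← v₂]
      exact (congrArg (fun p : (E × E) × (E →L[ℝ] E) => p.1.1) w₂).symm
    · rw [← v₁]
      exact (congrArg (fun p : (E × E) × (E →L[ℝ] E) => p.1.2) w₁).symm

/-- The curve through `x` with constant velocity `v` in the preferred chart at `x`. -/
def pointCurve (x : M) (v : E) (t : ℝ) : M :=
  (extChartAt 𝓘(ℝ, E) x).symm (extChartAt 𝓘(ℝ, E) x x + t • v)

lemma pointCurve_zero (x : M) (v : E) : pointCurve x v 0 = x := by
  simp [pointCurve]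

lemma contMDiffAt_pointCurve (x : M) (v : E) :
    ContMDiffAt 𝓘(ℝ, ℝ) 𝓘(ℝ, E) ∞ (pointCurve x v) 0 := by
  have h := contMDiffOn_extChartAt_symm (I := 𝓘(ℝ, E)) (n := ∞) x
  have h' := h.contMDiffAt (extChartAt_target_mem_nhds (I := 𝓘(ℝ, E)) x)
  refine ContMDiffAt.comp_of_eq (y := extChartAt 𝓘(ℝ, E) x x) h' ?_ (by simp)
  refine ContDiffAt.contMDiffAt ?_
  fun_prop

lemma mfderiv_pointCurve (x : M) (v : E) :
    mfderiv 𝓘(ℝ, ℝ) 𝓘(ℝ, E) (pointCurve x v) 0 (1 : ℝ) = v := by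
  have h := (contMDiffAt_pointCurve x v).mdifferentiableAt (by simp)
  have h' : HasMFDerivAt 𝓘(ℝ, E) 𝓘(ℝ, E) (extChartAt 𝓘(ℝ, E) x) (pointCurve x v 0)
      (ContinuousLinearMap.id ℝ E) := by
    rw [pointCurve_zero]
    exact hasMFDerivAt_extChartAt_self x
  have hc := h'.comp 0 h.hasMFDerivAt
  have hl : HasFDerivAt (fun t : ℝ => extChartAt 𝓘(ℝ, E) x x + t • v)
      (ContinuousLinearMap.toSpanSingleton ℝ v) 0 :=
    (ContinuousLinearMap.toSpanSingleton ℝ v).hasFDerivAt.const_add _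
  have ht : ∀ᶠ t in nhds (0 : ℝ),
      extChartAt 𝓘(ℝ, E) x x + t • v ∈ (extChartAt 𝓘(ℝ, E) x).target := by
    refine hl.continuousAt.eventually ?_
    simpa using extChartAt_target_mem_nhds (I := 𝓘(ℝ, E)) x
  have hc' := hc.congr_of_eventuallyEq (f₁ := fun t : ℝ => extChartAt 𝓘(ℝ, E) x x + t • v) <| by
    filter_upwards [ht] with t ht
    exact ((extChartAt 𝓘(ℝ, E) x).right_inv ht).symm
  exact (DFunLike.congr_fun (hasMFDerivAt_unique hc' hl.hasMFDerivAt) (1 : ℝ)).trans (one_smul ℝ v)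

/-- The curve of linear maps between the tangent spaces along two curves of the form `pointCurve`
which is affine in the preferred charts. -/
def linCurve (x y : M) (L : E →L[ℝ] E) (X : (E × E) × (E →L[ℝ] E)) (t : ℝ) :
    TangentSpace 𝓘(ℝ, E) (pointCurve x X.1.2 t) →L[ℝ] TangentSpace 𝓘(ℝ, E) (pointCurve y X.1.1 t) :=
  chartVec y (pointCurve y X.1.1 t) ∘L (L + t • X.2) ∘L chartCoord x (pointCurve x X.1.2 t)

lemma eventually_pointCurve_mem (x : M) (v : E) :
    ∀ᶠ t in nhds (0 : ℝ), pointCurve x v t ∈ (chartAt E x).source := by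
  have h := (contMDiffAt_pointCurve x v).continuousAt.eventually (eventually_mem_chartAt_source (E := E) _)
  rwa [pointCurve_zero] at h

lemma fibreCoord_linCurve (x y : M) (L : E →L[ℝ] E) (X : (E × E) × (E →L[ℝ] E)) :
    ∀ᶠ t in nhds (0 : ℝ), fibreCoord (y, x) (ofLin (linCurve x y L X t)) = L + t • X.2 := by
  filter_upwards [eventually_pointCurve_mem x X.1.2, eventually_pointCurve_mem y X.1.1] with t h h'
  ext v
  rw [fibreCoord_ofLin h h', linCurve, ContinuousLinearMap.comp_apply,
    ContinuousLinearMap.comp_apply, chartCoord_chartVec h, chartCoord_chartVec h']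

lemma linCurve_zero {x y : M} (L : TangentSpace 𝓘(ℝ, E) x →L[ℝ] TangentSpace 𝓘(ℝ, E) y)
    (X : (E × E) × (E →L[ℝ] E)) : ofLin (linCurve x y (modelLin L) X 0) = ofLin L := by
  have h : ∀ x' y' : M, x' = x → y' = y → ofLin (chartVec y y' ∘L (modelLin L + (0 : ℝ) • X.2) ∘L
      chartCoord x x') = ofLin L := by
    rintro _ _ rfl rfl
    refine congrArg ofLin (ContinuousLinearMap.ext fun v => ?_)
    rw [ContinuousLinearMap.comp_apply, ContinuousLinearMap.comp_apply, chartCoord_self,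
      chartVec_self, zero_smul, add_zero]
    rfl
  exact h _ _ (pointCurve_zero ..) (pointCurve_zero ..)

lemma contMDiffAt_linCurve {x y : M} (L : TangentSpace 𝓘(ℝ, E) x →L[ℝ] TangentSpace 𝓘(ℝ, E) y)
    (X : (E × E) × (E →L[ℝ] E)) :
    ContMDiffAt 𝓘(ℝ, ℝ) (HomModel E) ∞ (fun t => ofLin (linCurve x y (modelLin L) X t)) 0 := by
  refine contMDiffAt_homTM_iff.2 ⟨⟨contMDiffAt_pointCurve .., contMDiffAt_pointCurve ..⟩, ?_⟩
  rw [linCurve_zero]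
  refine ContMDiffAt.congr_of_eventuallyEq ?_ (fibreCoord_linCurve x y (modelLin L) X)
  refine ContDiffAt.contMDiffAt ?_
  fun_prop

lemma velocity_linCurve {x y : M} (L : TangentSpace 𝓘(ℝ, E) x →L[ℝ] TangentSpace 𝓘(ℝ, E) y)
    (X : (E × E) × (E →L[ℝ] E)) :
    velocity (fun t => ofLin (linCurve x y (modelLin L) X t)) = ⟨ofLin L, X⟩ := by
  refine tangentBundle_homTM_ext (linCurve_zero L X) ?_
  refine (mfderiv_homTM_apply ((contMDiffAt_linCurve L X).mdifferentiableAt (by simp)) (1 : ℝ)).trans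
    (Prod.ext (Prod.ext ?_ ?_) ?_)
  · exact mfderiv_pointCurve ..
  · exact mfderiv_pointCurve ..
  · rw [linCurve_zero]
    have h := ((ContinuousLinearMap.toSpanSingleton ℝ X.2).hasFDerivAt (x := (0 : ℝ))).const_add
      (modelLin L)
    have h' := h.congr_of_eventuallyEq (fibreCoord_linCurve x y (modelLin L) X)
    exact (DFunLike.congr_fun h'.hasMFDerivAt.mfderiv (1 : ℝ)).trans (one_smul ℝ X.2)

/-- The product rule holds for every admissible pair of curves, so the product depends only on the
two velocities. Curves that are affine in the charts realise every composable pair. -/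
lemma isTangentMul_iff {x y z : M} {A : TangentSpace 𝓘(ℝ, E) x →L[ℝ] TangentSpace 𝓘(ℝ, E) y}
    {B : TangentSpace 𝓘(ℝ, E) y →L[ℝ] TangentSpace 𝓘(ℝ, E) z}
    {X₁ X₂ : (E × E) × (E →L[ℝ] E)} {W : TangentBundle (HomModel E) (HomTM E M)} :
    IsTangentMul ⟨ofLin B, X₂⟩ ⟨ofLin A, X₁⟩ W ↔ X₂.1.2 = X₁.1.1 ∧
      W = ⟨ofLin (B ∘L A), (((X₂.1.1, X₁.1.2), X₂.2 ∘L modelLin A + modelLin B ∘L X₁.2) :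
        (E × E) × (E →L[ℝ] E))⟩ := by
  constructor
  · rintro ⟨x', y', z', c₁, c₂, h₁, h₂, v₁, v₂, rfl⟩
    exact velocity_comp h₁ h₂ v₁ v₂
  · obtain ⟨⟨b, a⟩, P⟩ := X₁
    obtain ⟨⟨c, b'⟩, Q⟩ := X₂
    rintro ⟨h, rfl⟩
    -- Once the middle velocities agree, both curves run over the same middle curve `pointCurve y
    -- b'`, hence are composable at all times.
    obtain rfl : b' = b := h
    have h₁ := contMDiffAt_linCurve A ((b', a), P)
    have h₂ := contMDiffAt_linCurve B ((c, b'), Q)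
    have v₁ := velocity_linCurve A ((b', a), P)
    have v₂ := velocity_linCurve B ((c, b'), Q)
    exact ⟨_, _, _, linCurve x y (modelLin A) ((b', a), P), linCurve y z (modelLin B) ((c, b'), Q),
      h₁, h₂, v₁, v₂, (velocity_comp (x := pointCurve x a) (y := pointCurve y b')
        (z := pointCurve z c) h₁ h₂ v₁ v₂).2⟩

/-! ### Bisections, symmetry jets and the affine distribution in coordinates. -/

namespace LocalBisection

lemma contMDiffAt_toSection (b : LocalBisection E M) {x : M} (hx : x ∈ b.source) :
    ContMDiffAt 𝓘(ℝ, E) (HomModel E) ∞ b.toSection x :=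
  b.contMDiffOn.contMDiffAt (b.base.open_source.mem_nhds hx)

/-- The derivative at `x` of `b`, in the preferred charts at `x` and `β(b(x))`. -/
def linDeriv (b : LocalBisection E M) (x : M) : E →L[ℝ] E →L[ℝ] E :=
  mfderiv 𝓘(ℝ, E) 𝓘(ℝ, E →L[ℝ] E) (fun x' => fibreCoord (b.base x, x) (b.toSection x')) x

lemma deriv_apply (b : LocalBisection E M) {x : M} (hx : x ∈ b.source) (X : E) :
    b.deriv x X = (((mfderiv 𝓘(ℝ, E) 𝓘(ℝ, E) b.base x X, X), b.linDeriv x X) :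
      (E × E) × (E →L[ℝ] E)) := by
  refine (mfderiv_homTM_apply
    ((b.contMDiffAt_toSection hx).mdifferentiableAt (by simp)) X).trans ?_
  refine Prod.ext (Prod.ext rfl ?_) rfl
  exact DFunLike.congr_fun (mfderiv_id (I := 𝓘(ℝ, E)) (x := x)) X

end LocalBisection

namespace SymmetryJet

variable (𝔰 : SymmetryJet E M)

/-- The derivative of the linear part of the symmetry jet at `x`, in the preferred chart at `x`. -/
def linDeriv (x : M) : E →L[ℝ] E →L[ℝ] E :=
  let L : E →L[ℝ] (E × E) × (E →L[ℝ] E) := 𝔰.lin x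
  ContinuousLinearMap.snd ℝ (E × E) (E →L[ℝ] E) ∘L L

lemma mem_source_rep (x : M) : x ∈ (𝔰.rep x).source := (𝔰.exists_rep x).choose_spec.1

lemma jet_rep (x : M) : (𝔰.rep x).jet x = (⟨negI E x, 𝔰.lin x⟩ : PreJet E M) :=
  (𝔰.exists_rep x).choose_spec.2

lemma toSection_rep (x : M) : (𝔰.rep x).toSection x = negI E x := congrArg Sigma.fst (𝔰.jet_rep x)

lemma base_rep (x : M) : (𝔰.rep x).base x = x := congrArg tgt (𝔰.toSection_rep x)

lemma deriv_rep (x : M) (X : E) :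
    ((𝔰.rep x).deriv x X : (E × E) × (E →L[ℝ] E)) = 𝔰.lin x X :=
  let f : PreJet E M → E →L[ℝ] (E × E) × (E →L[ℝ] E) := fun p => p.2
  have h : f ((𝔰.rep x).jet x) = f ⟨negI E x, 𝔰.lin x⟩ := congrArg f (𝔰.jet_rep x)
  DFunLike.congr_fun h X

lemma linDeriv_rep (x : M) (X : E) : (𝔰.rep x).linDeriv x X = 𝔰.linDeriv x X := by
  have h := 𝔰.deriv_rep x X
  rw [LocalBisection.deriv_apply _ (𝔰.mem_source_rep x)] at h
  exact congrArg Prod.snd h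

/-- The target component comes from the condition on `p_*`, and the source component from `α ∘ s_x =
id`. -/
lemma lin_apply (x : M) (X : E) :
    (𝔰.lin x X : (E × E) × (E →L[ℝ] E)) = ((-X, X), 𝔰.linDeriv x X) := by
  have h := 𝔰.deriv_rep x X
  rw [LocalBisection.deriv_apply _ (𝔰.mem_source_rep x)] at h
  refine Prod.ext (Prod.ext ?_ ?_) rfl
  · exact (dtgt_apply (negI E x) _).symm.trans (𝔰.pStar_eq x X)
  · exact (congrArg (fun p : (E × E) × (E →L[ℝ] E) => p.1.2) h).symm

lemma mfderiv_base_rep (x : M) (X : E) :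
    mfderiv 𝓘(ℝ, E) 𝓘(ℝ, E) (𝔰.rep x).base x X = -X := by
  have h := 𝔰.deriv_rep x X
  rw [LocalBisection.deriv_apply _ (𝔰.mem_source_rep x), lin_apply] at h
  exact congrArg (fun p : (E × E) × (E →L[ℝ] E) => p.1.1) h

/-- The product rule is applied twice. The factors `-I` on the two sides cancel on `P` but leave one
sign on each term in `𝔰.linDeriv`; the lift of `a` through `β_* = -1` is that of `-a`, which flips
the sign at `x` once more. -/
lemma isPsi_iff {x y : M} (A : TangentSpace 𝓘(ℝ, E) x →L[ℝ] TangentSpace 𝓘(ℝ, E) y)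
    (v w : (E × E) × (E →L[ℝ] E)) :
    𝔰.IsPsi (ofLin A) v w ↔ w = ((-v.1.1, -v.1.2),
      v.2 + modelLin A ∘L 𝔰.linDeriv x v.1.2 - 𝔰.linDeriv y v.1.1 ∘L modelLin A) := by
  obtain ⟨⟨b, a⟩, P⟩ := v
  have hlin (x : M) (u : E) : (⟨negI E x, 𝔰.lin x u⟩ : TangentBundle (HomModel E) (HomTM E M)) =
      ⟨ofLin (-(ContinuousLinearMap.id ℝ (TangentSpace 𝓘(ℝ, E) x))),
        (((-u, u), 𝔰.linDeriv x u) : (E × E) × (E →L[ℝ] E))⟩ :=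
    tangentBundle_homTM_ext rfl (𝔰.lin_apply x u)
  have hpt : ofLin (-(ContinuousLinearMap.id ℝ (TangentSpace 𝓘(ℝ, E) y)) ∘L
      (A ∘L (-(ContinuousLinearMap.id ℝ (TangentSpace 𝓘(ℝ, E) x))))) = ofLin A := by
    refine congrArg ofLin (ContinuousLinearMap.ext fun v => ?_)
    exact (congrArg (fun w => -w) (map_neg A v)).trans (neg_neg _)
  have hval (u u' : E) (hu : -u = a) (hu' : u' = b) :
      (((-u', u), 𝔰.linDeriv y u' ∘L
        modelLin (A ∘L (-(ContinuousLinearMap.id ℝ (TangentSpace 𝓘(ℝ, E) x)))) +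
        modelLin (-(ContinuousLinearMap.id ℝ (TangentSpace 𝓘(ℝ, E) y))) ∘L
          (P ∘L modelLin (-(ContinuousLinearMap.id ℝ (TangentSpace 𝓘(ℝ, E) x))) +
            modelLin A ∘L 𝔰.linDeriv x u)) : (E × E) × (E →L[ℝ] E)) =
      ((-b, -a), P + modelLin A ∘L 𝔰.linDeriv x a - 𝔰.linDeriv y b ∘L modelLin A) := by
    subst hu hu'
    refine Prod.ext (by simp) (ContinuousLinearMap.ext fun e => ?_)
    have e₁ : modelLin (A ∘L (-(ContinuousLinearMap.id ℝ (TangentSpace 𝓘(ℝ, E) x)))) e =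
      -modelLin A e := map_neg A e
    have e₂ (x : M) (e : E) : modelLin (-(ContinuousLinearMap.id ℝ (TangentSpace 𝓘(ℝ, E) x))) e =
      -e := rfl
    simp only [add_apply, sub_apply, ContinuousLinearMap.comp_apply, e₁, e₂, map_neg]
    rw [neg_apply, map_neg]
    abel
  have hX (u : E) : dtgt (negI E x) (𝔰.lin x u) = -u :=
    (dtgt_apply _ _).trans (congrArg (fun p : (E × E) × (E →L[ℝ] E) => p.1.1) (𝔰.lin_apply x u))
  have hY (u : E) : dsrc (negI E y) (𝔰.lin y u) = u :=
    (dsrc_apply _ _).trans (congrArg (fun p : (E × E) × (E →L[ℝ] E) => p.1.2) (𝔰.lin_apply y u))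
  have h₁ (u : E) (W : TangentBundle (HomModel E) (HomTM E M)) :=
    (iff_of_eq (congrArg (fun q => IsTangentMul (⟨ofLin A, (((b, a), P) :
      (E × E) × (E →L[ℝ] E))⟩ : TangentBundle (HomModel E) (HomTM E M)) q W)
        (hlin x u))).trans isTangentMul_iff
  have h₂ (u : E) (W W' : TangentBundle (HomModel E) (HomTM E M)) :=
    iff_of_eq (congrArg (fun q => IsTangentMul q W W') (hlin y u))
  constructor
  · rintro ⟨u, u', W, hu, hu', hW, hw⟩
    have hu₁ : -u = a := (hX u).symm.trans (hu.trans (dsrc_apply _ _))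
    have hu₂ : u' = b := (hY u').symm.trans (hu'.trans (dtgt_apply _ _))
    obtain ⟨-, rfl⟩ := (h₁ u W).1 hW
    have hw' := (isTangentMul_iff.1 ((h₂ u' _ _).1 hw)).2
    refine Eq.trans ?_ (hval u u' hu₁ hu₂)
    let f : TangentBundle (HomModel E) (HomTM E M) → (E × E) × (E →L[ℝ] E) := fun p => p.2
    exact congrArg f hw'
  · rintro rfl
    refine ⟨(-a : E), (b : E), _, (hX _).trans ((neg_neg a).trans (dsrc_apply (ofLin A) ((b, a), P)).symm),
      (hY _).trans (dtgt_apply (ofLin A) ((b, a), P)).symm, (h₁ _ _).2 ⟨(neg_neg a).symm, rfl⟩,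
      (h₂ _ _ _).2 (isTangentMul_iff.2 ⟨rfl, ?_⟩)⟩
    exact tangentBundle_homTM_ext hpt.symm (hval (-a) b (neg_neg a) rfl).symm

/-- The base components of `ψ(v) = -v` hold automatically. The linear component has `P` on one side
and `-P` on the other, whence the factor `2`. -/
lemma mem_affineDistribution_iff {x y : M}
    (A : TangentSpace 𝓘(ℝ, E) x →L[ℝ] TangentSpace 𝓘(ℝ, E) y) (v : (E × E) × (E →L[ℝ] E)) :
    v ∈ 𝔰.affineDistribution (ofLin A) ↔ v.1.1 = modelLin A v.1.2 ∧
      (2 : ℝ) • v.2 = 𝔰.linDeriv y v.1.1 ∘L modelLin A - modelLin A ∘L 𝔰.linDeriv x v.1.2 := by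
  have h1 : v ∈ 𝔰.affineDistribution (ofLin A) ↔
    𝔰.IsPsi (ofLin A) v (-v : (E × E) × (E →L[ℝ] E)) ∧
      dtgt (ofLin A) v = toLin (ofLin A) (dsrc (ofLin A) v) := Iff.rfl
  have h2 : dtgt (ofLin A) v = toLin (ofLin A) (dsrc (ofLin A) v) ↔
      v.1.1 = modelLin A v.1.2 := by
    rw [dtgt_apply, dsrc_apply]
    rfl
  rw [h1, h2, isPsi_iff, and_comm]
  refine and_congr_right fun h => ?_
  obtain ⟨⟨b, a⟩, P⟩ := v
  simp only [Prod.neg_mk, Prod.mk.injEq, true_and, two_smul]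
  constructor
  · intro h
    rw [← sub_eq_zero]
    rw [← sub_eq_zero] at h
    rw [← neg_eq_zero, ← h]
    abel
  · intro h
    rw [← sub_eq_zero]
    rw [← sub_eq_zero] at h
    rw [← neg_eq_zero, ← h]
    abel

end SymmetryJet

/-! ### Vector fields, Lie brackets and the induced connection in coordinates. -/

/-- The coordinates of a vector field in the preferred chart at `x₀`. -/
def fieldCoord (x₀ : M) (Y : ∀ x : M, TangentSpace 𝓘(ℝ, E) x) (x : M) : E := chartCoord x₀ x (Y x)

lemma fieldCoord_self (x : M) (Y : ∀ x : M, TangentSpace 𝓘(ℝ, E) x) : fieldCoord x Y x = Y x :=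
  chartCoord_self _ _

lemma mdifferentiableAt_section_iff_fieldCoord {x₀ : M} {Y : ∀ x : M, TangentSpace 𝓘(ℝ, E) x} :
    MDifferentiableAt 𝓘(ℝ, E) (𝓘(ℝ, E).prod 𝓘(ℝ, E))
      (fun x => (⟨x, Y x⟩ : TangentBundle 𝓘(ℝ, E) M)) x₀ ↔
    MDifferentiableAt 𝓘(ℝ, E) 𝓘(ℝ, E) (fieldCoord x₀ Y) x₀ := by
  rw [mdifferentiableAt_section]
  refine Filter.EventuallyEq.mdifferentiableAt_iff ?_
  filter_upwards [eventually_mem_chartAt_source (E := E) x₀] with x hx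
  exact ((trivializationAt E (TangentSpace 𝓘(ℝ, E)) x₀).continuousLinearMapAt_apply_of_mem ℝ hx
    (Y x)).symm

lemma mpullbackWithin_extChartAt_symm (x₀ : M) (Y : ∀ x : M, TangentSpace 𝓘(ℝ, E) x) :
    VectorField.mpullbackWithin 𝓘(ℝ, E) 𝓘(ℝ, E) (extChartAt 𝓘(ℝ, E) x₀).symm Y
      (range 𝓘(ℝ, E)) =ᶠ[nhds (extChartAt 𝓘(ℝ, E) x₀ x₀)]
      fieldCoord x₀ Y ∘ (extChartAt 𝓘(ℝ, E) x₀).symm := by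
  filter_upwards [extChartAt_target_mem_nhds (I := 𝓘(ℝ, E)) x₀] with u hu
  have hx : (extChartAt 𝓘(ℝ, E) x₀).symm u ∈ (chartAt E x₀).source := by
    simpa using (extChartAt 𝓘(ℝ, E) x₀).map_target hu
  have h := TangentBundle.symmL_trivializationAt (I := 𝓘(ℝ, E)) hx
  rw [(extChartAt 𝓘(ℝ, E) x₀).right_inv hu] at h
  rw [VectorField.mpullbackWithin_apply, ← h]
  refine DFunLike.congr_fun (ContinuousLinearMap.inverse_eq (g := chartCoord x₀ _) ?_ ?_) _
  · ext v
    exact chartVec_chartCoord hx v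
  · ext v
    exact chartCoord_chartVec hx v

/-- The derivative at `x` of a vector field, in the preferred chart at `x`. -/
def fieldDeriv (x : M) (Y : ∀ x : M, TangentSpace 𝓘(ℝ, E) x) : E →L[ℝ] E :=
  mfderiv 𝓘(ℝ, E) 𝓘(ℝ, E) (fieldCoord x Y) x

lemma mlieBracket_eq {x : M} {X Y : ∀ x : M, TangentSpace 𝓘(ℝ, E) x}
    (hX : MDifferentiableAt 𝓘(ℝ, E) 𝓘(ℝ, E) (fieldCoord x X) x)
    (hY : MDifferentiableAt 𝓘(ℝ, E) 𝓘(ℝ, E) (fieldCoord x Y) x) :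
    VectorField.mlieBracket 𝓘(ℝ, E) X Y x = fieldDeriv x Y (X x) - fieldDeriv x X (Y x) := by
  have hfd {Z : ∀ x : M, TangentSpace 𝓘(ℝ, E) x}
      (hZ : MDifferentiableAt 𝓘(ℝ, E) 𝓘(ℝ, E) (fieldCoord x Z) x) :
      fderiv ℝ (VectorField.mpullbackWithin 𝓘(ℝ, E) 𝓘(ℝ, E) (extChartAt 𝓘(ℝ, E) x).symm Z
        (range 𝓘(ℝ, E))) (extChartAt 𝓘(ℝ, E) x x) = fieldDeriv x Z := by
    rw [(mpullbackWithin_extChartAt_symm x Z).fderiv_eq, fieldDeriv, hZ.mfderiv]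
    simp only [modelWithCornersSelf_coe, range_id, fderivWithin_univ]
    rfl
  have hv (Z : ∀ x : M, TangentSpace 𝓘(ℝ, E) x) :
      VectorField.mpullbackWithin 𝓘(ℝ, E) 𝓘(ℝ, E) (extChartAt 𝓘(ℝ, E) x).symm Z
        (range 𝓘(ℝ, E)) (extChartAt 𝓘(ℝ, E) x x) = Z x := by
    refine (mpullbackWithin_extChartAt_symm x Z).eq_of_nhds.trans ?_
    rw [Function.comp_apply, extChartAt_to_inv, fieldCoord_self]
  have hb (V W : E → E) (u : E) : VectorField.lieBracketWithin ℝ V W (range 𝓘(ℝ, E)) u =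
      fderiv ℝ W u (V u) - fderiv ℝ V u (W u) := by
    simp [VectorField.lieBracketWithin]
  rw [← VectorField.mlieBracketWithin_univ, VectorField.mlieBracketWithin_apply,
    mfderiv_extChartAt_self, preimage_univ, univ_inter]
  refine (DFunLike.congr_fun ContinuousLinearMap.inverse_id _).trans ((hb _ _ _).trans ?_)
  rw [hfd hX, hfd hY, hv, hv]

lemma hasMFDerivAt_clm_apply {g : M → E →L[ℝ] E} {f : M → E} {x : M} {g' : E →L[ℝ] E →L[ℝ] E}
    {f' : E →L[ℝ] E} (hg : HasMFDerivAt 𝓘(ℝ, E) 𝓘(ℝ, E →L[ℝ] E) g x g')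
    (hf : HasMFDerivAt 𝓘(ℝ, E) 𝓘(ℝ, E) f x f') :
    HasMFDerivAt 𝓘(ℝ, E) 𝓘(ℝ, E) (fun y => g y (f y)) x (g x ∘L f' + g'.flip (f x)) := by
  refine ⟨hg.1.clm_apply hf.1, ?_⟩
  have h := HasFDerivWithinAt.clm_apply hg.2 hf.2
  simp only [writtenInExtChartAt, extChartAt_model_space_eq_id, PartialEquiv.refl_coe,
    Function.comp_apply, id_eq, extChartAt_to_inv] at h
  exact h

namespace LocalBisection

lemma toSection_model (b : LocalBisection E M) (x : M) :
    fibreCoord (b.base x, x) (b.toSection x) = modelLin (b.lin x) :=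
  fibreCoord_eq_modelLin _

/-- The derivative of the image of a vector field under a local bisection. -/
lemma fieldDeriv_image (b : LocalBisection E M) {x : M} (hx : x ∈ b.source)
    {Y Z : ∀ x : M, TangentSpace 𝓘(ℝ, E) x}
    (hY : MDifferentiableAt 𝓘(ℝ, E) 𝓘(ℝ, E) (fieldCoord x Y) x)
    (hZ : ∀ x' ∈ b.source, Z (b.base x') = b.lin x' (Y x')) :
    MDifferentiableAt 𝓘(ℝ, E) 𝓘(ℝ, E) (fieldCoord (b.base x) Z) (b.base x) ∧
      ∀ X : E, fieldDeriv (b.base x) Z (mfderiv 𝓘(ℝ, E) 𝓘(ℝ, E) b.base x X) =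
        b.linDeriv x X (Y x) + modelLin (b.lin x) (fieldDeriv x Y X) := by
  have hB := ((contMDiffAt_homTM_iff.1 (b.contMDiffAt_toSection hx)).2.mdifferentiableAt
    (by simp)).hasMFDerivAt
  have hF := hasMFDerivAt_clm_apply hB hY.hasMFDerivAt
  have hbase : MDifferentiableAt 𝓘(ℝ, E) 𝓘(ℝ, E) b.base x :=
    b.base.mdifferentiableAt (by simp) hx
  have hsrc := b.base.open_source.mem_nhds hx
  have ev : ∀ᶠ x' in nhds x, fieldCoord (b.base x) Z (b.base x') =
      fibreCoord (b.base x, x) (b.toSection x') (fieldCoord x Y x') := by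
    filter_upwards [hsrc, eventually_mem_chartAt_source (E := E) x,
      hbase.continuousAt.eventually (eventually_mem_chartAt_source (E := E) _)] with x' h₁ h₂ h₃
    refine Eq.trans ?_ (fibreCoord_ofLin h₂ h₃ (b.lin x') _).symm
    rw [fieldCoord, hZ x' h₁, fieldCoord, chartVec_chartCoord h₂]
  -- The hypothesis describes `Z` only along `b.base`, so differentiability is obtained by composing
  -- with the inverse diffeomorphism.
  have hd : MDifferentiableAt 𝓘(ℝ, E) 𝓘(ℝ, E) (fieldCoord (b.base x) Z) (b.base x) := by
    have ht : b.base x ∈ b.base.target := b.base.map_source hx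
    have hs : MDifferentiableAt 𝓘(ℝ, E) 𝓘(ℝ, E) b.base.symm (b.base x) :=
      b.base.symm.mdifferentiableAt (by simp) ht
    have hl : b.base.symm (b.base x) = x := b.base.left_inv hx
    have hG : MDifferentiableAt 𝓘(ℝ, E) 𝓘(ℝ, E) (fun x' => fibreCoord (b.base x, x)
      (b.toSection x') (fieldCoord x Y x')) (b.base.symm (b.base x)) := by
      rw [hl]
      exact hF.mdifferentiableAt
    refine (hG.comp (b.base x) hs).congr_of_eventuallyEq ?_
    have hc := hs.continuousAt
    rw [ContinuousAt, hl] at hc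
    filter_upwards [hc.eventually ev, b.base.open_target.mem_nhds ht] with y h₁ h₂
    refine Eq.trans ?_ h₁
    exact congrArg (fieldCoord (b.base x) Z) (b.base.right_inv h₂).symm
  refine ⟨hd, fun X => ?_⟩
  have hc := hd.hasMFDerivAt.comp x hbase.hasMFDerivAt
  have he := hasMFDerivAt_unique hc (hF.congr_of_eventuallyEq ev)
  refine (DFunLike.congr_fun he X).trans ?_
  refine (add_comm _ _).trans ?_
  rw [fieldCoord_self]
  refine congrArg₂ _ rfl ?_
  exact DFunLike.congr_fun (b.toSection_model x) _

lemma pushforward_base (b : LocalBisection E M) (Y : ∀ x : M, TangentSpace 𝓘(ℝ, E) x) {x : M}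
    (hx : x ∈ b.source) : b.pushforward Y (b.base x) = b.lin x (Y x) := by
  have ht : b.base x ∈ b.base.target := b.base.map_source hx
  rw [pushforward, dif_pos ht]
  -- Generalising the point `β⁻¹(β(x))` to `z` makes the transport disappear on substitution.
  have h : ∀ (z : M) (_ : z = x) (h : b.base z = b.base x), h ▸ b.lin z (Y z) = b.lin x (Y x) := by
    rintro _ rfl _
    rfl
  exact h _ (b.base.left_inv hx) _

end LocalBisection

namespace SymmetryJet

variable (𝔰 : SymmetryJet E M)

lemma lin_rep (x : M) (v : E) : modelLin ((𝔰.rep x).lin x) v = -v := by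
  let f : HomTM E M → E →L[ℝ] E := fun ξ => ξ.2
  have h : f ((𝔰.rep x).toSection x) = f (negI E x) := congrArg f (𝔰.toSection_rep x)
  exact DFunLike.congr_fun h v

/-- At `x` both `s_x` and the derivative of its base map are `-I`. Evaluating the image formula at
`-X` makes the two signs on `DY` cancel and leaves one on the jet term. -/
lemma fieldDeriv_pushforward_rep {x : M} {Y : ∀ x : M, TangentSpace 𝓘(ℝ, E) x}
    (hY : MDifferentiableAt 𝓘(ℝ, E) 𝓘(ℝ, E) (fieldCoord x Y) x) :
    (𝔰.rep x).pushforward Y x = -Y x ∧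
    MDifferentiableAt 𝓘(ℝ, E) 𝓘(ℝ, E) (fieldCoord x ((𝔰.rep x).pushforward Y)) x ∧
      ∀ X : E, fieldDeriv x ((𝔰.rep x).pushforward Y) X =
        fieldDeriv x Y X - 𝔰.linDeriv x X (Y x) := by
  have h₀ := (𝔰.rep x).pushforward_base Y (𝔰.mem_source_rep x)
  have h := (𝔰.rep x).fieldDeriv_image (𝔰.mem_source_rep x) hY
    (fun x' => (𝔰.rep x).pushforward_base Y)
  have key : ∀ y : M, (𝔰.rep x).base x = y → ((𝔰.rep x).pushforward Y y : E) = -Y x ∧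
    MDifferentiableAt 𝓘(ℝ, E) 𝓘(ℝ, E) (fieldCoord y ((𝔰.rep x).pushforward Y)) y ∧
      ∀ X : E, fieldDeriv y ((𝔰.rep x).pushforward Y) X =
        fieldDeriv x Y X - 𝔰.linDeriv x X (Y x) := by
    rintro _ rfl
    refine ⟨h₀.trans (𝔰.lin_rep x (Y x)), h.1, fun X => ?_⟩
    have e : mfderiv 𝓘(ℝ, E) 𝓘(ℝ, E) (𝔰.rep x).base x (-X : E) = X :=
      (𝔰.mfderiv_base_rep x (-X)).trans (neg_neg X)
    refine (congrArg (fieldDeriv _ ((𝔰.rep x).pushforward Y)) e).symm.trans ((h.2 (-X)).trans ?_)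
    rw [𝔰.lin_rep, 𝔰.linDeriv_rep]
    have alg (S : E →L[ℝ] E →L[ℝ] E) (D : E →L[ℝ] E) (y : E) :
        S (-X) y + -(D (-X)) = D X - S X y := by
      rw [map_neg, map_neg, neg_apply]
      abel
    exact alg ..
  exact key x (𝔰.base_rep x)

/-- Since `s_x(Y)` equals `-Y` at `x`, the field `Y + s_x(Y)` vanishes there and the derivative of
`X` drops out of the bracket. The derivative of `Y` occurs twice, which the factor `1/2`
compensates. -/
lemma connection_eq {x : M} {X Y : ∀ x : M, TangentSpace 𝓘(ℝ, E) x}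
    (hX : MDifferentiableAt 𝓘(ℝ, E) 𝓘(ℝ, E) (fieldCoord x X) x)
    (hY : MDifferentiableAt 𝓘(ℝ, E) 𝓘(ℝ, E) (fieldCoord x Y) x) :
    𝔰.connection X Y x =
      fieldDeriv x Y (X x) - (1 / 2 : ℝ) • 𝔰.linDeriv x (X x) (Y x) := by
  obtain ⟨h₀, hZ, h⟩ := 𝔰.fieldDeriv_pushforward_rep hY
  have hadd : fieldCoord x (Y + (𝔰.rep x).pushforward Y) =
      fieldCoord x Y + fieldCoord x ((𝔰.rep x).pushforward Y) :=
    funext fun x' => map_add (chartCoord x x') _ _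
  have hd := hY.hasMFDerivAt.add hZ.hasMFDerivAt
  rw [← hadd] at hd
  have e₁ (v : E) : fieldDeriv x (Y + (𝔰.rep x).pushforward Y) v =
      fieldDeriv x Y v + fieldDeriv x ((𝔰.rep x).pushforward Y) v :=
    DFunLike.congr_fun hd.mfderiv v
  have e₂ : (Y + (𝔰.rep x).pushforward Y) x = 0 := by
    rw [Pi.add_apply, h₀, add_neg_cancel]
  have alg (d s : E) : (1 / 2 : ℝ) • (d + (d - s) - 0) = d - (1 / 2 : ℝ) • s := by module
  refine Eq.trans (congrArg (fun w : E => (1 / 2 : ℝ) • w) ?_) (alg _ _)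
  refine (mlieBracket_eq hX hd.mdifferentiableAt).trans (congrArg₂ (fun v w : E => v - w) ?_ ?_)
  · exact (e₁ _).trans (congrArg (fun w : E => fieldDeriv x Y (X x) + w) (h _))
  · exact (congrArg (fieldDeriv x X) e₂).trans (map_zero _)

end SymmetryJet

/-! ### The equations for leaves and for affine maps. -/

/-- Affinity is tested on vector fields, whereas its coordinate equation concerns vectors at one
point. A bump function equal to `1` at `x` cuts off a local extension; the Hausdorff property makes
the result globally smooth. -/
lemma exists_contMDiff_field [T2Space M] (x : M) (v : TangentSpace 𝓘(ℝ, E) x) :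
    ∃ X : ∀ x : M, TangentSpace 𝓘(ℝ, E) x, X x = v ∧
      ContMDiff 𝓘(ℝ, E) (𝓘(ℝ, E).prod 𝓘(ℝ, E)) ∞
        (fun x => (⟨x, X x⟩ : TangentBundle 𝓘(ℝ, E) M)) := by
  obtain ⟨s, hs, hX⟩ := FiberBundle.exists_contMDiffOn_extend (k := ∞) 𝓘(ℝ, E) E v
  obtain ⟨u, hus, hu, hxu⟩ := mem_nhds_iff.1 hs
  obtain ⟨f, -, hf⟩ := (SmoothBumpFunction.nhds_basis_tsupport (I := 𝓘(ℝ, E)) x).mem_iff.1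
    (hu.mem_nhds hxu)
  refine ⟨(f : M → ℝ) • FiberBundle.extend E v, ?_,
    ContMDiffOn.smul_section_of_tsupport f.contMDiff.contMDiffOn hu hf (hX.mono hus)⟩
  simp

namespace SymmetryJet

variable (𝔰 : SymmetryJet E M)

/-- An element of the distribution is determined by its source component, and `b_{*x}` already
attains every source component. Thus inclusion of the image in the distribution forces equality. -/
lemma isLeaf_iff (b : LocalBisection E M) :
    𝔰.IsLeaf b ↔ ∀ x ∈ b.source, ∀ X : E,
      mfderiv 𝓘(ℝ, E) 𝓘(ℝ, E) b.base x X = modelLin (b.lin x) X ∧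
      (2 : ℝ) • b.linDeriv x X = 𝔰.linDeriv (b.base x) (modelLin (b.lin x) X) ∘L modelLin (b.lin x) -
        modelLin (b.lin x) ∘L 𝔰.linDeriv x X := by
  refine forall₂_congr fun x hx => ?_
  have hmem (v : (E × E) × (E →L[ℝ] E)) : v ∈ 𝔰.affineDistribution (b.toSection x) ↔ _ :=
    𝔰.mem_affineDistribution_iff (b.lin x) v
  let D : E →L[ℝ] (E × E) × (E →L[ℝ] E) := b.deriv x
  have hD (X : E) : D X =
      (((mfderiv 𝓘(ℝ, E) 𝓘(ℝ, E) b.base x X : E), X), b.linDeriv x X) := b.deriv_apply hx X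
  have hleaf : range (b.deriv x) = 𝔰.affineDistribution (b.toSection x) ↔
      ∀ v, (∃ X, D X = v) ↔ v.1.1 = modelLin (b.lin x) v.1.2 ∧ (2 : ℝ) • v.2 =
        𝔰.linDeriv (b.base x) v.1.1 ∘L modelLin (b.lin x) -
          modelLin (b.lin x) ∘L 𝔰.linDeriv x v.1.2 :=
    Set.ext_iff.trans (forall_congr' fun v => iff_congr Iff.rfl (hmem v))
  rw [hleaf]
  constructor
  · intro h X
    have h₁ := (h (D X)).1 ⟨X, rfl⟩
    rw [hD] at h₁
    refine ⟨h₁.1, h₁.2.trans ?_⟩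
    exact congrArg (fun w : E => 𝔰.linDeriv (b.base x) w ∘L modelLin (b.lin x) -
      modelLin (b.lin x) ∘L 𝔰.linDeriv x X) h₁.1
  · intro h v
    constructor
    · rintro ⟨X, rfl⟩
      rw [hD]
      refine ⟨(h X).1, (h X).2.trans ?_⟩
      exact congrArg (fun w : E => 𝔰.linDeriv (b.base x) w ∘L modelLin (b.lin x) -
        modelLin (b.lin x) ∘L 𝔰.linDeriv x X) (h X).1.symm
    · obtain ⟨⟨c, a⟩, P⟩ := v
      rintro ⟨h₁, h₂⟩
      obtain rfl : c = modelLin (b.lin x) a := h₁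
      refine ⟨a, (hD a).trans (Prod.ext (Prod.ext (h a).1 rfl) ?_)⟩
      exact smul_right_injective _ (two_ne_zero (α := ℝ)) ((h a).2.trans h₂.symm)

lemma isAffine_iff [T2Space M] (φ : LocalDiffeo E M) :
    𝔰.IsAffine φ ↔ ∀ x ∈ φ.source, ∀ X Y : E,
      (2 : ℝ) • (j1 φ).linDeriv x X Y =
        𝔰.linDeriv (φ x) (modelLin ((j1 φ).lin x) X) (modelLin ((j1 φ).lin x) Y) -
        modelLin ((j1 φ).lin x) (𝔰.linDeriv x X Y) := by
  have main (x : M) (hx : x ∈ φ.source) (X Y : ∀ x : M, TangentSpace 𝓘(ℝ, E) x)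
      (hX : ContMDiffOn 𝓘(ℝ, E) (𝓘(ℝ, E).prod 𝓘(ℝ, E)) ∞
        (fun x => (⟨x, X x⟩ : TangentBundle 𝓘(ℝ, E) M)) φ.source)
      (hY : ContMDiffOn 𝓘(ℝ, E) (𝓘(ℝ, E).prod 𝓘(ℝ, E)) ∞
        (fun x => (⟨x, Y x⟩ : TangentBundle 𝓘(ℝ, E) M)) φ.source) :
      mfderiv 𝓘(ℝ, E) 𝓘(ℝ, E) φ x (𝔰.connection X Y x) =
        𝔰.connection (VectorField.mpullback 𝓘(ℝ, E) 𝓘(ℝ, E) φ.symm X)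
          (VectorField.mpullback 𝓘(ℝ, E) 𝓘(ℝ, E) φ.symm Y) (φ x) ↔
      (2 : ℝ) • (j1 φ).linDeriv x (X x) (Y x) =
        𝔰.linDeriv (φ x) (modelLin ((j1 φ).lin x) (X x)) (modelLin ((j1 φ).lin x) (Y x)) -
        modelLin ((j1 φ).lin x) (𝔰.linDeriv x (X x) (Y x)) := by
    have hd {Z : ∀ x : M, TangentSpace 𝓘(ℝ, E) x}
        (hZ : ContMDiffOn 𝓘(ℝ, E) (𝓘(ℝ, E).prod 𝓘(ℝ, E)) ∞
          (fun x => (⟨x, Z x⟩ : TangentBundle 𝓘(ℝ, E) M)) φ.source) :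
        MDifferentiableAt 𝓘(ℝ, E) 𝓘(ℝ, E) (fieldCoord x Z) x :=
      mdifferentiableAt_section_iff_fieldCoord.1
        ((hZ.contMDiffAt (φ.open_source.mem_nhds hx)).mdifferentiableAt (by simp))
    -- This identifies `φ_* Z` with the image of `Z` under the bisection `j1 φ`, so that
    -- `fieldDeriv_image` applies; the derivatives of `φ` and `φ.symm` are mutually inverse.
    have hpull (Z : ∀ x : M, TangentSpace 𝓘(ℝ, E) x) (x' : M) (hx' : x' ∈ (j1 φ).source) :
        VectorField.mpullback 𝓘(ℝ, E) 𝓘(ℝ, E) φ.symm Z ((j1 φ).base x') =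
          (j1 φ).lin x' (Z x') := by
      have hl : φ.symm (φ x') = x' := φ.left_inv hx'
      have ht : φ x' ∈ φ.target := φ.map_source hx'
      have d₁ : MDifferentiableAt 𝓘(ℝ, E) 𝓘(ℝ, E) φ x' := φ.mdifferentiableAt (by simp) hx'
      have d₂ : MDifferentiableAt 𝓘(ℝ, E) 𝓘(ℝ, E) φ.symm (φ x') :=
        φ.symm.mdifferentiableAt (by simp) ht
      have e₁ := hasMFDerivAt_unique (d₂.hasMFDerivAt.comp x' d₁.hasMFDerivAt)
        ((hasMFDerivAt_id x').congr_of_eventuallyEq <| by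
          filter_upwards [φ.open_source.mem_nhds hx'] with z hz
          exact φ.left_inv hz)
      have d₁' : HasMFDerivAt 𝓘(ℝ, E) 𝓘(ℝ, E) φ (φ.symm (φ x'))
          (mfderiv 𝓘(ℝ, E) 𝓘(ℝ, E) φ x' : E →L[ℝ] E) := by
        rw [hl]
        exact d₁.hasMFDerivAt
      have e₂ := hasMFDerivAt_unique (d₁'.comp (φ x') d₂.hasMFDerivAt)
        ((hasMFDerivAt_id (φ x')).congr_of_eventuallyEq <| by
          filter_upwards [φ.open_target.mem_nhds ht] with z hz
          exact φ.right_inv hz)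
      let A : E →L[ℝ] E := mfderiv 𝓘(ℝ, E) 𝓘(ℝ, E) φ x'
      let B : E →L[ℝ] E := mfderiv 𝓘(ℝ, E) 𝓘(ℝ, E) φ.symm (φ x')
      have hinv : B.inverse = A := ContinuousLinearMap.inverse_eq e₁ e₂
      let f : M → E := Z
      have hf : f (φ.symm (φ x')) = f x' := congrArg f hl
      exact (congrArg B.inverse hf).trans (DFunLike.congr_fun hinv (f x'))
    obtain ⟨dX, -⟩ := (j1 φ).fieldDeriv_image hx (hd hX) (hpull X)
    obtain ⟨dY, hdY⟩ := (j1 φ).fieldDeriv_image hx (hd hY) (hpull Y)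
    have hl := congrArg (modelLin ((j1 φ).lin x)) (𝔰.connection_eq (hd hX) (hd hY))
    have hr := 𝔰.connection_eq dX dY
    -- Here `d` is the derivative of `Y` and `l` the second derivative of `φ`: the terms `A d`
    -- cancel, leaving a condition free of derivatives of the fields.
    have alg (A : E →L[ℝ] E) (d s l s' : E) : A (d - (1 / 2 : ℝ) • s) =
        l + A d - (1 / 2 : ℝ) • s' ↔ (2 : ℝ) • l = s' - A s := by
      rw [map_sub, map_smul]
      constructor
      · intro h
        have h' : l = (1 / 2 : ℝ) • s' - (1 / 2 : ℝ) • A s := by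
          rw [← sub_eq_zero] at h ⊢
          rw [← neg_eq_zero, ← h]
          abel
        rw [h']
        module
      · intro h
        have h' : l = (1 / 2 : ℝ) • (s' - A s) := by
          rw [← h]
          module
        rw [h']
        module
    refine Iff.trans (iff_of_eq (congrArg₂ (fun v w : E => v = w) hl (hr.trans ?_)))
      (alg (modelLin ((j1 φ).lin x)) (fieldDeriv x Y (X x)) (𝔰.linDeriv x (X x) (Y x))
        ((j1 φ).linDeriv x (X x) (Y x))
        (𝔰.linDeriv (φ x) (modelLin ((j1 φ).lin x) (X x)) (modelLin ((j1 φ).lin x) (Y x))))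
    refine congrArg₂ (fun v w : E => v - (1 / 2 : ℝ) • w) ?_ ?_
    · exact (congrArg (fieldDeriv (E := E) (φ x)
        (VectorField.mpullback 𝓘(ℝ, E) 𝓘(ℝ, E) φ.symm Y)) (hpull X x hx)).trans (hdY (X x))
    · exact congrArg₂ (fun v w : E => 𝔰.linDeriv (φ x) v w) (hpull X x hx) (hpull Y x hx)
  constructor
  · intro h x hx X Y
    obtain ⟨X', hX, hX'⟩ := exists_contMDiff_field x (X : TangentSpace 𝓘(ℝ, E) x)
    obtain ⟨Y', hY, hY'⟩ := exists_contMDiff_field x (Y : TangentSpace 𝓘(ℝ, E) x)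
    have h' := (main x hx X' Y' hX'.contMDiffOn hY'.contMDiffOn).1
      (h X' Y' hX'.contMDiffOn hY'.contMDiffOn x hx)
    rw [hX, hY] at h'
    exact h'
  · intro h X Y hX hY x hx
    exact (main x hx X Y hX hY).2 (h x hx _ _)

lemma isAffine_iff_isLeaf_j1 [T2Space M] (φ : LocalDiffeo E M) :
    𝔰.IsAffine φ ↔ 𝔰.IsLeaf (j1 φ) := by
  rw [isAffine_iff, isLeaf_iff]
  refine forall₂_congr fun x hx => ⟨fun h X => ⟨rfl, ?_⟩, fun h X Y => ?_⟩
  · exact ContinuousLinearMap.ext (h X)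
  · exact DFunLike.congr_fun (h X).2 Y

end SymmetryJet

/-! ### From leaves back to diffeomorphisms. -/

lemma j1_base_same {b : LocalBisection E M}
    (h : ∀ x ∈ b.source, ∀ X : E, mfderiv 𝓘(ℝ, E) 𝓘(ℝ, E) b.base x X = modelLin (b.lin x) X) :
    (j1 b.base).Same b :=
  ⟨rfl, fun x hx => congrArg (ofLin (x := x) (y := b.base x)) (ContinuousLinearMap.ext (h x hx))⟩

namespace LocalBisection

/-- Being a leaf depends only on the germs of the section at points of its domain. -/
lemma Same.isLeaf {𝔰 : SymmetryJet E M} {b b' : LocalBisection E M} (h : b.Same b') (hb : 𝔰.IsLeaf b') :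
    𝔰.IsLeaf b := by
  intro x hx
  have hx' : x ∈ b'.source := h.1 ▸ hx
  have e : b.toSection =ᶠ[nhds x] b'.toSection :=
    Filter.eventuallyEq_of_mem (b.base.open_source.mem_nhds hx) h.2
  have key : ∀ (ξ : HomTM E M) (L : E →L[ℝ] (E × E) × (E →L[ℝ] E)), b'.toSection x = ξ →
    (b'.deriv x : E →L[ℝ] (E × E) × (E →L[ℝ] E)) = L →
      (range L : Set (TangentSpace (HomModel E) ξ)) = 𝔰.affineDistribution ξ := by
    rintro _ _ rfl rfl
    exact hb x hx'
  exact key _ _ (h.2 hx).symm e.mfderiv_eq.symm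

end LocalBisection

lemma same_of_j1_same {φ ψ : LocalDiffeo E M} (h : (j1 φ).Same (j1 ψ)) : φ.Same ψ :=
  ⟨h.1, fun _ hx => congrArg tgt (h.2 hx)⟩

/-- The diffeomorphism given by a local diffeomorphism of `M` onto `M` which is defined on `M`. -/
def LocalDiffeo.toDiffeomorph (φ : LocalDiffeo E M) (h : φ.source = univ) (h' : φ.target = univ) :
    M ≃ₘ⟮𝓘(ℝ, E), 𝓘(ℝ, E)⟯ M where
  toFun := φ
  invFun := φ.symm
  left_inv x := φ.left_inv (h ▸ mem_univ x)
  right_inv x := φ.right_inv (h' ▸ mem_univ x)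
  contMDiff_toFun := contMDiffOn_univ.1 (φ.contMDiffOn_toFun.mono h.symm.subset)
  contMDiff_invFun := contMDiffOn_univ.1 (φ.contMDiffOn_invFun.mono h'.symm.subset)

end

end AffineJets

theorem proposition3p8 {E : Type*} [NormedAddCommGroup E] [NormedSpace ℝ E] [FiniteDimensional ℝ E]
    {M : Type*} [TopologicalSpace M] [T2Space M] [ChartedSpace E M] [IsManifold 𝓘(ℝ, E) ∞ M]
    (𝔰 : AffineJets.SymmetryJet E M) :
    -- local affine diffeomorphisms and local bisections
    ((∀ φ : AffineJets.LocalDiffeo E M, 𝔰.IsAffine φ ↔ 𝔰.IsLeaf (AffineJets.j1 φ)) ∧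
      (∀ φ ψ : AffineJets.LocalDiffeo E M,
        (AffineJets.j1 φ).Same (AffineJets.j1 ψ) → φ.Same ψ) ∧
      (∀ b : AffineJets.LocalBisection E M, 𝔰.IsLeaf b →
        ∃ φ : AffineJets.LocalDiffeo E M, 𝔰.IsAffine φ ∧ (AffineJets.j1 φ).Same b)) ∧
    -- global affine diffeomorphisms and global bisections
    ((∀ φ : M ≃ₘ⟮𝓘(ℝ, E), 𝓘(ℝ, E)⟯ M, 𝔰.IsAffine φ.toPartialDiffeomorph ↔
        𝔰.IsLeaf (AffineJets.j1 φ.toPartialDiffeomorph)) ∧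
      (∀ φ ψ : M ≃ₘ⟮𝓘(ℝ, E), 𝓘(ℝ, E)⟯ M,
        (AffineJets.j1 φ.toPartialDiffeomorph).Same (AffineJets.j1 ψ.toPartialDiffeomorph) →
          φ = ψ) ∧
      (∀ b : AffineJets.LocalBisection E M, b.source = univ → b.target = univ → 𝔰.IsLeaf b →
        ∃ φ : M ≃ₘ⟮𝓘(ℝ, E), 𝓘(ℝ, E)⟯ M, 𝔰.IsAffine φ.toPartialDiffeomorph ∧
          (AffineJets.j1 φ.toPartialDiffeomorph).Same b)) := by
  refine ⟨⟨𝔰.isAffine_iff_isLeaf_j1, fun _ _ => AffineJets.same_of_j1_same, fun b hb => ?_⟩,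
    fun φ => 𝔰.isAffine_iff_isLeaf_j1 _, fun φ ψ h => ?_, fun b hs ht hb => ?_⟩
  · have h := AffineJets.j1_base_same fun x hx X => ((𝔰.isLeaf_iff b).1 hb x hx X).1
    exact ⟨b.base, (𝔰.isAffine_iff_isLeaf_j1 _).2 (h.isLeaf hb), h⟩
  · exact Diffeomorph.ext fun x => (AffineJets.same_of_j1_same h).2 (Set.mem_univ x)
  · have h : (AffineJets.j1 (b.base.toDiffeomorph hs ht).toPartialDiffeomorph).Same b := by
      have h := AffineJets.j1_base_same fun x hx X => ((𝔰.isLeaf_iff b).1 hb x hx X).1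
      -- The local statement applies because the global diffeomorphism has the same underlying map
      -- as `b.base`.
      exact ⟨hs.symm, fun x _ => h.2 (hs ▸ Set.mem_univ x)⟩
    exact ⟨b.base.toDiffeomorph hs ht, (𝔰.isAffine_iff_isLeaf_j1 _).2 (h.isLeaf hb), h⟩
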